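/- All manifolds are smooth, finite-dimensional, Hausdorff, second countable and without boundary (not necessarily connected). A Liouville form on a manifold $X$ is a smooth $1$-form $\lambda$ whose differential $d\lambda$ is symplectic; its Liouville field is the vector field $Z$ with $\iota(Z)\,d\lambda=\lambda$. A compact domain with smooth boundary is a compact set $D\subset X$ that near each point of its topological boundary is a sublevel set $\{f\le 0\}$ of a smooth function $f$ vanishing with non-zero differential at that point; $Z$ is outward pointing along $\partial D$ if $df(Z)>0$ at these points. A convex symplectic manifold $(X,\omega)$ with Liouville form $\mu$ is a symplectic manifold without compact connected components together with a smooth $1$-form $\mu$ with $d\mu=\omega$ such that the Liouville field $Z$ of $\mu$ is complete and there is an exhaustion $X=\bigcup_{j\ge1}X_j$, $X_j\subset X_{j+1}$, by compact domains with smooth boundaries along which $Z$ is outward pointing. A smooth family $\mu_s$, $s\in[0,1]$, of Liouville forms on $X$, with Liouville fields $Z_s$, is a simple Liouville homotopy if there are smooth families $X^k_s$, $s\in[0,1]$, $k\ge 1$, of compact domains with smooth boundaries (that is, $X^k_s=\psi^k_s(X^k_0)$ for a smooth isotopy $\psi^k_s$ of $X$ with $\psi^k_0=\mathrm{id}$)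 such that for every $s$ one has $X^k_s\subset X^{k+1}_s$, $X=\bigcup_k X^k_s$, and $Z_s$ is outward pointing along $\partial X^k_s$ for all $k$. A Liouville homotopy is a composition of finitely many simple ones: a family $\mu_s$, $s\in[0,1]$, for which there is a partition $0=t_0<\dots<t_N=1$ such that each restriction $\mu|_{[t_i,t_{i+1}]}$, linearly reparametrized by $[0,1]$, is a simple Liouville homotopy. **Proposition.** Let $(X,\omega)$ and $(X',\omega')$ be convex symplectic manifolds with Liouville forms $\mu$ and $\mu'$, respectively, and suppose that $(X,\omega)$ and $(X',\omega')$ are symplectomorphic. Then there exist a symplectomorphism $\varphi\colon(X,\omega)\to(X',\omega')$ and a Liouville homotopy $\mu_s$, $s\in[0,1]$, on $X$ with $\mu_0=\mu$ and $\mu_1=\varphi^*\mu'$. -/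

import Mathlib

open Set Filter Topology
open scoped Manifold ContDiff

noncomputable section

namespace Liouville

section Forms

variable {E : Type*} [NormedAddCommGroup E] [NormedSpace ℝ E]
variable {E' : Type*} [NormedAddCommGroup E'] [NormedSpace ℝ E']
variable {X : Type*} [TopologicalSpace X] [ChartedSpace E X]
variable {X' : Type*} [TopologicalSpace X'] [ChartedSpace E' X']

/-- A (not necessarily smooth) differential `k`-form on a manifold `X` without boundary
modelled on `E`. -/
abbrev DForm (E : Type*) [NormedAddCommGroup E] [NormedSpace ℝ E]
    (X : Type*) [TopologicalSpace X] [ChartedSpace E X] (k : ℕ) : Type _ :=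
  (x : X) → TangentSpace 𝓘(ℝ, E) x [⋀^Fin k]→L[ℝ] ℝ

/-- Pullback of a `k`-form by a map. -/
def DForm.pullback {k : ℕ} (φ : X → X') (η : DForm E' X' k) : DForm E X k := fun x =>
  (η (φ x)).compContinuousLinearMap (mfderiv 𝓘(ℝ, E) 𝓘(ℝ, E') φ x)

/-- The coordinate expression of a `k`-form in the preferred chart at `x₀`: its pullback by the
inverse of the chart, meaningful on the target of the chart. -/
def DForm.inChart {k : ℕ} (η : DForm E X k) (x₀ : X) : E → E [⋀^Fin k]→L[ℝ] ℝ := fun y =>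
  (η ((extChartAt 𝓘(ℝ, E) x₀).symm y)).compContinuousLinearMap
    (mfderiv 𝓘(ℝ, E) 𝓘(ℝ, E) (extChartAt 𝓘(ℝ, E) x₀).symm y)

/-- A form is smooth if its coordinate expressions are. -/
def DForm.IsSmooth {k : ℕ} (η : DForm E X k) : Prop :=
  ∀ x₀ : X, ContDiffOn ℝ ∞ (η.inChart x₀) (extChartAt 𝓘(ℝ, E) x₀).target

/-- A family `η s`, `s ∈ [0,1]`, of forms is smooth if its coordinate expressions are jointly
smooth in the parameter and the coordinates. -/
def DForm.IsSmoothFamily {k : ℕ} (η : ℝ → DForm E X k) : Prop :=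
  ∀ x₀ : X, ContDiffOn ℝ ∞ (fun p : ℝ × E => (η p.1).inChart x₀ p.2)
    (Icc (0 : ℝ) 1 ×ˢ (extChartAt 𝓘(ℝ, E) x₀).target)

/-- Exterior derivative, computed at each point `x` in the preferred chart at `x`. -/
def DForm.d {k : ℕ} (η : DForm E X k) : DForm E X (k + 1) := fun x =>
  (extDeriv (η.inChart x) (extChartAt 𝓘(ℝ, E) x x)).compContinuousLinearMap
    (mfderiv 𝓘(ℝ, E) 𝓘(ℝ, E) (extChartAt 𝓘(ℝ, E) x) x)

/-- Symplectic forms: smooth, closed, nondegenerate `2`-forms. -/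
structure IsSymplectic (σ : DForm E X 2) : Prop where
  smooth : σ.IsSmooth
  closed : ∀ x, σ.d x = 0
  nondegenerate : ∀ (x : X) (v : TangentSpace 𝓘(ℝ, E) x),
    (∀ w : TangentSpace 𝓘(ℝ, E) x, σ x ![v, w] = 0) → v = 0

/-- `lam` is a Liouville form for `σ`: a smooth primitive of the symplectic form `σ`. -/
structure IsLiouvilleFormFor (σ : DForm E X 2) (lam : DForm E X 1) : Prop where
  symplectic : IsSymplectic σ
  smooth : lam.IsSmooth
  d_eq : lam.d = σ

/-- `lam` is a Liouville form (for the symplectic form `d lam`). -/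
def IsLiouvilleForm (lam : DForm E X 1) : Prop := IsLiouvilleFormFor lam.d lam

/-- `Z` is the vector field dual to `lam` with respect to `σ`, i.e. `ι(Z) σ = lam`. -/
def IsDualField (σ : DForm E X 2) (lam : DForm E X 1)
    (Z : (x : X) → TangentSpace 𝓘(ℝ, E) x) : Prop :=
  ∀ (x : X) (w : TangentSpace 𝓘(ℝ, E) x), σ x ![Z x, w] = lam x ![w]

/-- Completeness of a vector field: all integral curves extend to `ℝ`. -/
def IsCompleteField (Z : (x : X) → TangentSpace 𝓘(ℝ, E) x) : Prop :=
  ∀ x : X, ∃ γ : ℝ → X, γ 0 = x ∧ IsMIntegralCurve (I := 𝓘(ℝ, E)) γ Z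

end Forms

section Domains

variable {E : Type*} [NormedAddCommGroup E] [NormedSpace ℝ E]
variable {X : Type*} [TopologicalSpace X] [ChartedSpace E X]

/-- `f` is a smooth function which near `p` is a regular defining function of `D`:
`D = {f ≤ 0}` near `p`, `f p = 0` and `df ≠ 0` at `p`. -/
structure IsDefiningFunctionAt (E : Type*) [NormedAddCommGroup E] [NormedSpace ℝ E]
    {X : Type*} [TopologicalSpace X] [ChartedSpace E X]
    (D : Set X) (f : X → ℝ) (p : X) : Prop where
  smooth : ContMDiff 𝓘(ℝ, E) 𝓘(ℝ, ℝ) ∞ f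
  zero : f p = 0
  regular : mfderiv 𝓘(ℝ, E) 𝓘(ℝ, ℝ) f p ≠ 0
  mem_iff : ∀ᶠ x in 𝓝 p, x ∈ D ↔ f x ≤ 0

/-- Compact domain with smooth boundary (a compact codimension `0` submanifold with boundary). -/
structure IsCompactDomain (E : Type*) [NormedAddCommGroup E] [NormedSpace ℝ E]
    {X : Type*} [TopologicalSpace X] [ChartedSpace E X] (D : Set X) : Prop where
  compact : IsCompact D
  smooth_boundary : ∀ p ∈ frontier D, ∃ f : X → ℝ, IsDefiningFunctionAt E D f p

/-- The vector field `Z` is outward pointing (in particular transverse) along the boundary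
of `D`: at each boundary point, `df (Z) > 0` for a defining function `f` of `D`. -/
def IsOutwardAlong (Z : (x : X) → TangentSpace 𝓘(ℝ, E) x) (D : Set X) : Prop :=
  ∀ p ∈ frontier D, ∃ f : X → ℝ, IsDefiningFunctionAt E D f p ∧
    (0 : ℝ) < mfderiv 𝓘(ℝ, E) 𝓘(ℝ, ℝ) f p (Z p)

/-- An exhaustion of `X` by a nested sequence of compact domains with smooth boundaries along
which `Z` is outward pointing. -/
structure IsConvexExhaustion (Z : (x : X) → TangentSpace 𝓘(ℝ, E) x) (V : ℕ → Set X) : Prop where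
  domain : ∀ j, IsCompactDomain E (V j)
  nested : ∀ j, V j ⊆ V (j + 1)
  exhausts : ⋃ j, V j = univ
  outward : ∀ j, IsOutwardAlong Z (V j)

/-- `D s`, `s ∈ [0,1]`, is a smooth family of domains: it is swept out by `D 0` under a smooth
isotopy of `X`. -/
def IsSmoothDomainFamily (E : Type*) [NormedAddCommGroup E] [NormedSpace ℝ E]
    {X : Type*} [TopologicalSpace X] [ChartedSpace E X] (D : ℝ → Set X) : Prop :=
  ∃ ψ : ℝ → Diffeomorph 𝓘(ℝ, E) 𝓘(ℝ, E) X X ∞,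
    ContMDiffOn (𝓘(ℝ, ℝ).prod 𝓘(ℝ, E)) 𝓘(ℝ, E) ∞ (fun p : ℝ × X => ψ p.1 p.2)
      (Icc (0 : ℝ) 1 ×ˢ univ) ∧
    (∀ x, ψ 0 x = x) ∧ ∀ s ∈ Icc (0 : ℝ) 1, D s = ψ s '' D 0

end Domains

section Convex

variable {E : Type*} [NormedAddCommGroup E] [NormedSpace ℝ E]
variable {E' : Type*} [NormedAddCommGroup E'] [NormedSpace ℝ E']
variable {X : Type*} [TopologicalSpace X] [ChartedSpace E X]
variable {X' : Type*} [TopologicalSpace X'] [ChartedSpace E' X']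

/-- `(X, σ)` is a convex symplectic (Liouville) manifold, with convex structure given by the
Liouville form `lam`: `X` is open (no component is compact), the Liouville field of `lam` is
complete, and there is an exhaustion by compact domains along whose smooth boundaries
it is outward pointing. -/
structure IsConvexSymplectic (σ : DForm E X 2) (lam : DForm E X 1) : Prop where
  open_manifold : ∀ x : X, ¬ IsCompact (connectedComponent x)
  liouville : IsLiouvilleFormFor σ lam
  convex : ∃ Z : (x : X) → TangentSpace 𝓘(ℝ, E) x,
    IsDualField σ lam Z ∧ IsCompleteField Z ∧ ∃ V : ℕ → Set X, IsConvexExhaustion Z V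

/-- A diffeomorphism is a symplectomorphism `(X, σ) → (X', σ')` if it pulls `σ'` back to `σ`. -/
def IsSymplectomorphism (σ : DForm E X 2) (σ' : DForm E' X' 2)
    (φ : Diffeomorph 𝓘(ℝ, E) 𝓘(ℝ, E') X X' ∞) : Prop :=
  DForm.pullback φ σ' = σ

/-- Simple Liouville homotopy `μ s`, `s ∈ [0,1]`. -/
structure IsSimpleLiouvilleHomotopy (μ : ℝ → DForm E X 1) : Prop where
  smooth : DForm.IsSmoothFamily μ
  liouville : ∀ s ∈ Icc (0 : ℝ) 1, IsLiouvilleForm (μ s)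
  exhaustions : ∃ D : ℕ → ℝ → Set X, (∀ k, IsSmoothDomainFamily E (D k)) ∧
    ∀ s ∈ Icc (0 : ℝ) 1, ∃ Z : (x : X) → TangentSpace 𝓘(ℝ, E) x,
      IsDualField (μ s).d (μ s) Z ∧ IsConvexExhaustion Z (fun k => D k s)

/-- Liouville homotopy `μ s`, `s ∈ [0,1]`: there is a partition `0 = t 0 < ⋯ < t N = 1` such that
on each piece, linearly reparametrized by `[0,1]`, `μ` is a simple Liouville homotopy. -/
def IsLiouvilleHomotopy (μ : ℝ → DForm E X 1) : Prop :=
  ∃ (N : ℕ) (t : ℕ → ℝ), t 0 = 0 ∧ t N = 1 ∧ (∀ i < N, t i < t (i + 1)) ∧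
    ∀ i < N, IsSimpleLiouvilleHomotopy (fun s => μ (t i + s * (t (i + 1) - t i)))

end Convex

end Liouville

end

/-! Any given symplectomorphism φ works, so everything reduces to two Liouville forms μ, μ' for one
symplectic form σ on X, with fields Z, Z' and convex exhaustions that need not be adapted to each
other. The field of (1-s)μ + sμ' mixes Z and Z' and need not point outward along either exhaustion.
The remedy is to pass through fμ + gμ', where f and g dominate each other alternately.

Interleave domains D_0 ⊂ D'_0 ⊂ D_1 ⊂ D'_1 ⊂ ..., with Z outward along ∂D_k and Z' along ∂D'_k
(`exists_interleaved_barriers`). Let f grow along Z only between D'_{k-1} and D_k, and g grow along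
Z' only between D_k and D'_k, with increments so large that g/f is small on ∂D_k and f/g is small on
∂D'_k (`exists_interpolating_functions`).

Nondegeneracy: d(aμ + bμ') = (a+b)σ + da∧μ + db∧μ'. If at most one of da, db is nonzero at each
point, and da(Z), db(Z') ≥ 0, this is nondegenerate by linear algebra (`eq_zero_of_wedge_eq_zero`,
`isLiouvilleForm_comb`).

Convexity: where da = db = 0 the Liouville field is (aZ + bZ')/(a+b), which points outward along
∂D_k once b/a is small. Hence the segment from μ to fμ + gμ' is a simple homotopy with the constant
domains D_k, and the segment from there to μ' is one with the constant domains D'_k.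

Completeness of Z and Z' enters only in showing that the interiors of the exhausting domains cover.
-/

noncomputable section

namespace Liouville

/-! ### Pullback and exterior derivative of forms, in charts -/

section Forms

variable {E : Type*} [NormedAddCommGroup E] [NormedSpace ℝ E]
variable {E' : Type*} [NormedAddCommGroup E'] [NormedSpace ℝ E']
variable {X : Type*} [TopologicalSpace X] [ChartedSpace E X]
variable {X' : Type*} [TopologicalSpace X'] [ChartedSpace E' X']

theorem mdifferentiableAt_extChartAt_symm [IsManifold 𝓘(ℝ, E) ∞ X] (x₀ : X) {y : E}
    (hy : y ∈ (extChartAt 𝓘(ℝ, E) x₀).target) :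
    MDifferentiableAt 𝓘(ℝ, E) 𝓘(ℝ, E) (extChartAt 𝓘(ℝ, E) x₀).symm y := by
  have : IsManifold 𝓘(ℝ, E) 1 X := IsManifold.of_le (n := ∞) (by norm_cast)
  have := mdifferentiableWithinAt_extChartAt_symm (I := 𝓘(ℝ, E)) hy
  simpa only [modelWithCornersSelf_coe, range_id, mdifferentiableWithinAt_univ] using this

theorem mdifferentiableAt_extChartAt' [IsManifold 𝓘(ℝ, E) ∞ X] (x₀ : X) {x : X}
    (hx : x ∈ (extChartAt 𝓘(ℝ, E) x₀).source) :
    MDifferentiableAt 𝓘(ℝ, E) 𝓘(ℝ, E) (extChartAt 𝓘(ℝ, E) x₀) x := by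
  have : IsManifold 𝓘(ℝ, E) 1 X := IsManifold.of_le (n := ∞) (by norm_cast)
  exact mdifferentiableAt_extChartAt (by simpa using hx)

/-- The coordinate expression of a map in the preferred charts at `x₀` and `x₁`. -/
def chartRep (E E' : Type*) [NormedAddCommGroup E] [NormedSpace ℝ E]
    [NormedAddCommGroup E'] [NormedSpace ℝ E'] {X : Type*} [TopologicalSpace X] [ChartedSpace E X]
    {X' : Type*} [TopologicalSpace X'] [ChartedSpace E' X'] (φ : X → X')
    (x₀ : X) (x₁ : X') : E → E' := fun y =>
  extChartAt 𝓘(ℝ, E') x₁ (φ ((extChartAt 𝓘(ℝ, E) x₀).symm y))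

theorem contDiffAt_chartRep [IsManifold 𝓘(ℝ, E) ∞ X] [IsManifold 𝓘(ℝ, E') ∞ X']
    {φ : X → X'} {x₀ : X} {x₁ : X'} {y : E} (hy : y ∈ (extChartAt 𝓘(ℝ, E) x₀).target)
    (hφ : ContMDiffAt 𝓘(ℝ, E) 𝓘(ℝ, E') ∞ φ ((extChartAt 𝓘(ℝ, E) x₀).symm y))
    (h₁ : φ ((extChartAt 𝓘(ℝ, E) x₀).symm y) ∈ (extChartAt 𝓘(ℝ, E') x₁).source) :
    ContDiffAt ℝ ∞ (chartRep E E' φ x₀ x₁) y := by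
  rw [← contMDiffAt_iff_contDiffAt]
  have h1 : ContMDiffAt 𝓘(ℝ, E) 𝓘(ℝ, E) ∞ (extChartAt 𝓘(ℝ, E) x₀).symm y :=
    (contMDiffOn_extChartAt_symm x₀).contMDiffAt (extChartAt_target_mem_nhds' hy)
  have h2 : ContMDiffAt 𝓘(ℝ, E') 𝓘(ℝ, E') ∞ (extChartAt 𝓘(ℝ, E') x₁)
      (φ ((extChartAt 𝓘(ℝ, E) x₀).symm y)) :=
    contMDiffAt_extChartAt' (by simpa using h₁)
  exact h2.comp y (hφ.comp y h1)

theorem fderiv_chartRep [IsManifold 𝓘(ℝ, E) ∞ X] [IsManifold 𝓘(ℝ, E') ∞ X']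
    {φ : X → X'} {x₀ : X} {x₁ : X'} {y : E} (hy : y ∈ (extChartAt 𝓘(ℝ, E) x₀).target)
    (hφ : MDifferentiableAt 𝓘(ℝ, E) 𝓘(ℝ, E') φ ((extChartAt 𝓘(ℝ, E) x₀).symm y))
    (h₁ : φ ((extChartAt 𝓘(ℝ, E) x₀).symm y) ∈ (extChartAt 𝓘(ℝ, E') x₁).source) (v : E) :
    fderiv ℝ (chartRep E E' φ x₀ x₁) y v =
      mfderiv 𝓘(ℝ, E') 𝓘(ℝ, E') (extChartAt 𝓘(ℝ, E') x₁) (φ ((extChartAt 𝓘(ℝ, E) x₀).symm y))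
        (mfderiv 𝓘(ℝ, E) 𝓘(ℝ, E') φ ((extChartAt 𝓘(ℝ, E) x₀).symm y)
          (mfderiv 𝓘(ℝ, E) 𝓘(ℝ, E) (extChartAt 𝓘(ℝ, E) x₀).symm y v)) := by
  have h1 := (mdifferentiableAt_extChartAt_symm x₀ hy).hasMFDerivAt
  have h2 := (mdifferentiableAt_extChartAt' x₁ h₁).hasMFDerivAt
  have h3 := h2.comp y (hφ.hasMFDerivAt.comp y h1)
  have := h3.mfderiv
  rw [mfderiv_eq_fderiv] at this
  exact congrArg (fun L => L v) this

theorem mfderiv_extChartAt_symm_mfderiv [IsManifold 𝓘(ℝ, E) ∞ X] (x₀ : X) {x : X}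
    (hx : x ∈ (extChartAt 𝓘(ℝ, E) x₀).source) (v : TangentSpace 𝓘(ℝ, E) x) :
    mfderiv 𝓘(ℝ, E) 𝓘(ℝ, E) (extChartAt 𝓘(ℝ, E) x₀).symm (extChartAt 𝓘(ℝ, E) x₀ x)
      (mfderiv 𝓘(ℝ, E) 𝓘(ℝ, E) (extChartAt 𝓘(ℝ, E) x₀) x v) = v := by
  have : IsManifold 𝓘(ℝ, E) 1 X := IsManifold.of_le (n := ∞) (by norm_cast)
  have h := mfderivWithin_extChartAt_symm_comp_mfderiv_extChartAt' (I := 𝓘(ℝ, E)) hx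
  simp only [modelWithCornersSelf_coe, range_id, mfderivWithin_univ] at h
  exact congrArg (fun L => L v) h

theorem mfderiv_extChartAt_mfderiv_symm [IsManifold 𝓘(ℝ, E) ∞ X] (x₀ : X) {y : E}
    (hy : y ∈ (extChartAt 𝓘(ℝ, E) x₀).target) (v : E) :
    mfderiv 𝓘(ℝ, E) 𝓘(ℝ, E) (extChartAt 𝓘(ℝ, E) x₀) ((extChartAt 𝓘(ℝ, E) x₀).symm y)
      (mfderiv 𝓘(ℝ, E) 𝓘(ℝ, E) (extChartAt 𝓘(ℝ, E) x₀).symm y v) = v := by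
  have : IsManifold 𝓘(ℝ, E) 1 X := IsManifold.of_le (n := ∞) (by norm_cast)
  have h := mfderiv_extChartAt_comp_mfderivWithin_extChartAt_symm (I := 𝓘(ℝ, E)) hy
  simp only [modelWithCornersSelf_coe, range_id, mfderivWithin_univ] at h
  exact congrArg (fun L => L v) h

namespace DForm

/-- Transport of the argument of a form along an equality of base points. -/
theorem apply_congr {k : ℕ} (η : DForm E X k) {x x' : X} (h : x = x') {v w : Fin k → E}
    (hvw : v = w) : (η x : E [⋀^Fin k]→L[ℝ] ℝ) v = (η x' : E [⋀^Fin k]→L[ℝ] ℝ) w := by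
  subst h; subst hvw; rfl

theorem inChart_pullback [IsManifold 𝓘(ℝ, E) ∞ X] [IsManifold 𝓘(ℝ, E') ∞ X'] {k : ℕ}
    {φ : X → X'} (η : DForm E' X' k) {x₀ : X} {x₁ : X'} {y : E}
    (hy : y ∈ (extChartAt 𝓘(ℝ, E) x₀).target)
    (hφ : MDifferentiableAt 𝓘(ℝ, E) 𝓘(ℝ, E') φ ((extChartAt 𝓘(ℝ, E) x₀).symm y))
    (h₁ : φ ((extChartAt 𝓘(ℝ, E) x₀).symm y) ∈ (extChartAt 𝓘(ℝ, E') x₁).source) :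
    (pullback φ η).inChart x₀ y =
      (η.inChart x₁ (chartRep E E' φ x₀ x₁ y)).compContinuousLinearMap
        (fderiv ℝ (chartRep E E' φ x₀ x₁) y) := by
  ext v
  refine apply_congr η ((extChartAt 𝓘(ℝ, E') x₁).left_inv h₁).symm ?_
  funext i
  have h2 := fderiv_chartRep hy hφ h₁ (v i)
  refine (mfderiv_extChartAt_symm_mfderiv x₁ h₁ _).symm.trans ?_
  exact congrArg _ h2.symm

theorem pullback_id {k : ℕ} (η : DForm E X k) : pullback (id : X → X) η = η := by
  funext x
  simp only [pullback, mfderiv_id]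
  rfl

theorem IsSmooth.contDiffAt {k : ℕ} {η : DForm E X k} (h : η.IsSmooth) {x₀ : X} {y : E}
    (hy : y ∈ (extChartAt 𝓘(ℝ, E) x₀).target) : ContDiffAt ℝ ∞ (η.inChart x₀) y :=
  (h x₀).contDiffAt (extChartAt_target_mem_nhds' hy)

theorem IsSmooth.differentiableAt {k : ℕ} {η : DForm E X k} (h : η.IsSmooth) {x₀ : X} {y : E}
    (hy : y ∈ (extChartAt 𝓘(ℝ, E) x₀).target) : DifferentiableAt ℝ (η.inChart x₀) y :=
  (h.contDiffAt hy).differentiableAt (by simp)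

theorem minSmoothness_two_le : minSmoothness ℝ 2 ≤ (∞ : WithTop ℕ∞) := by
  simp only [minSmoothness_of_isRCLikeNormedField]
  exact WithTop.coe_le_coe.2 le_top

theorem eventually_mem_target_and_source [IsManifold 𝓘(ℝ, E) ∞ X] [IsManifold 𝓘(ℝ, E') ∞ X']
    {φ : X → X'} {x₀ : X} {x₁ : X'} {y : E} (hy : y ∈ (extChartAt 𝓘(ℝ, E) x₀).target)
    (hφ : ContinuousAt φ ((extChartAt 𝓘(ℝ, E) x₀).symm y))
    (h₁ : φ ((extChartAt 𝓘(ℝ, E) x₀).symm y) ∈ (extChartAt 𝓘(ℝ, E') x₁).source) :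
    ∀ᶠ z in 𝓝 y, z ∈ (extChartAt 𝓘(ℝ, E) x₀).target ∧
      φ ((extChartAt 𝓘(ℝ, E) x₀).symm z) ∈ (extChartAt 𝓘(ℝ, E') x₁).source := by
  have hc : ContinuousAt (extChartAt 𝓘(ℝ, E) x₀).symm y := continuousAt_extChartAt_symm'' hy
  exact Filter.Eventually.and (extChartAt_target_mem_nhds' hy)
    ((ContinuousAt.comp (f := (extChartAt 𝓘(ℝ, E) x₀).symm) hφ hc).eventually
      ((isOpen_extChartAt_source x₁).mem_nhds h₁))

/-- Chart expressions turn φ into a smooth map between open subsets of the model spaces, where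
`extDeriv_pullback` applies. The case φ = id gives chart independence of `d`. -/
theorem extDeriv_inChart_pullback [IsManifold 𝓘(ℝ, E) ∞ X] [IsManifold 𝓘(ℝ, E') ∞ X'] {k : ℕ}
    {φ : X → X'} {η : DForm E' X' k} (hη : η.IsSmooth) {x₀ : X} {x₁ : X'} {y : E}
    (hy : y ∈ (extChartAt 𝓘(ℝ, E) x₀).target) (hφ : ContMDiff 𝓘(ℝ, E) 𝓘(ℝ, E') ∞ φ)
    (h₁ : φ ((extChartAt 𝓘(ℝ, E) x₀).symm y) ∈ (extChartAt 𝓘(ℝ, E') x₁).source) :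
    extDeriv ((pullback φ η).inChart x₀) y =
      (extDeriv (η.inChart x₁) (chartRep E E' φ x₀ x₁ y)).compContinuousLinearMap
        (fderiv ℝ (chartRep E E' φ x₀ x₁) y) := by
  have hev : (pullback φ η).inChart x₀ =ᶠ[𝓝 y] fun z =>
      (η.inChart x₁ (chartRep E E' φ x₀ x₁ z)).compContinuousLinearMap
        (fderiv ℝ (chartRep E E' φ x₀ x₁) z) := by
    filter_upwards [eventually_mem_target_and_source hy hφ.continuous.continuousAt h₁] with z hz
    exact inChart_pullback η hz.1 ((hφ _).mdifferentiableAt (by simp)) hz.2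
  rw [hev.extDeriv_eq]
  refine extDeriv_pullback (hη.differentiableAt ?_) (contDiffAt_chartRep hy (hφ _) h₁)
    minSmoothness_two_le
  exact (extChartAt 𝓘(ℝ, E') x₁).map_source h₁

/-- The exterior derivative may be computed in any preferred chart. -/
theorem inChart_d [IsManifold 𝓘(ℝ, E) ∞ X] {k : ℕ} {η : DForm E X k} (hη : η.IsSmooth) {x₀ : X}
    {y : E} (hy : y ∈ (extChartAt 𝓘(ℝ, E) x₀).target) :
    η.d.inChart x₀ y = extDeriv (η.inChart x₀) y := by
  have hs : (id : X → X) ((extChartAt 𝓘(ℝ, E) x₀).symm y) ∈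
      (extChartAt 𝓘(ℝ, E) ((extChartAt 𝓘(ℝ, E) x₀).symm y)).source := mem_extChartAt_source _
  have h := extDeriv_inChart_pullback (φ := id) hη hy contMDiff_id hs
  rw [pullback_id] at h
  rw [h]
  ext v
  refine congrArg (extDeriv _ _) ?_
  funext i
  refine Eq.trans ?_ (fderiv_chartRep hy mdifferentiableAt_id hs (v i)).symm
  simp only [mfderiv_id]
  rfl

theorem d_pullback [IsManifold 𝓘(ℝ, E) ∞ X] [IsManifold 𝓘(ℝ, E') ∞ X'] {k : ℕ}
    {φ : X → X'} {η : DForm E' X' k} (hη : η.IsSmooth) (hφ : ContMDiff 𝓘(ℝ, E) 𝓘(ℝ, E') ∞ φ) :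
    (pullback φ η : DForm E X k).d = pullback φ η.d := by
  funext x
  have hl := (extChartAt 𝓘(ℝ, E) x).left_inv (mem_extChartAt_source x)
  have hs : φ ((extChartAt 𝓘(ℝ, E) x).symm (extChartAt 𝓘(ℝ, E) x x)) ∈
      (extChartAt 𝓘(ℝ, E') (φ x)).source := by rw [hl]; exact mem_extChartAt_source _
  have hy := mem_extChartAt_target (I := 𝓘(ℝ, E)) x
  ext v
  have h := extDeriv_inChart_pullback hη hy hφ hs
  simp only [d, pullback] at h ⊢
  erw [h]
  have hrep : chartRep E E' φ x (φ x) (extChartAt 𝓘(ℝ, E) x x) =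
      extChartAt 𝓘(ℝ, E') (φ x) (φ x) := by
    simp only [chartRep, hl]
  rw [hrep]
  refine congrArg (extDeriv _ _) ?_
  funext i
  refine (fderiv_chartRep hy ((hφ _).mdifferentiableAt (by simp)) hs _).trans ?_
  erw [mfderiv_extChartAt_symm_mfderiv x (mem_extChartAt_source x)]
  rw [hl]
  rfl

theorem IsSmooth.d [IsManifold 𝓘(ℝ, E) ∞ X] {k : ℕ} {η : DForm E X k} (hη : η.IsSmooth) :
    η.d.IsSmooth := by
  intro x₀
  have h : ContDiffOn ℝ ∞ (fun y => extDeriv (η.inChart x₀) y)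
      (extChartAt 𝓘(ℝ, E) x₀).target := by
    intro y hy
    have h1 : ContDiffAt ℝ ∞ (fderiv ℝ (η.inChart x₀)) y :=
      (hη.contDiffAt hy).fderiv_right (by simp)
    exact ((ContinuousAlternatingMap.alternatizeUncurryFinCLM ℝ E ℝ).contDiff.contDiffAt.comp y
      h1).contDiffWithinAt
  exact h.congr fun y hy => inChart_d hη hy

theorem d_d [IsManifold 𝓘(ℝ, E) ∞ X] {k : ℕ} {η : DForm E X k} (hη : η.IsSmooth) (x : X) :
    η.d.d x = 0 := by
  have hy := mem_extChartAt_target (I := 𝓘(ℝ, E)) x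
  have h : extDeriv (η.d.inChart x) (extChartAt 𝓘(ℝ, E) x x) = 0 := by
    have hev : η.d.inChart x =ᶠ[𝓝 (extChartAt 𝓘(ℝ, E) x x)] extDeriv (η.inChart x) := by
      filter_upwards [extChartAt_target_mem_nhds' hy] with y hy' using inChart_d hη hy'
    rw [hev.extDeriv_eq]
    exact extDeriv_extDeriv_apply (hη.contDiffAt hy) minSmoothness_two_le
  simp only [DForm.d] at h ⊢
  rw [h]
  rfl

/-- In degree one, forms are linear functionals, and pulling back is composition with the derivative
of φ, a smooth operation on continuous linear maps. -/
theorem IsSmooth.pullback_one [IsManifold 𝓘(ℝ, E) ∞ X] [IsManifold 𝓘(ℝ, E') ∞ X']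
    {φ : X → X'} {η : DForm E' X' 1} (hη : η.IsSmooth) (hφ : ContMDiff 𝓘(ℝ, E) 𝓘(ℝ, E') ∞ φ) :
    (pullback φ η : DForm E X 1).IsSmooth := by
  intro x₀ y hy
  refine ContDiffAt.contDiffWithinAt ?_
  set x₁ := φ ((extChartAt 𝓘(ℝ, E) x₀).symm y)
  have h₁ : φ ((extChartAt 𝓘(ℝ, E) x₀).symm y) ∈ (extChartAt 𝓘(ℝ, E') x₁).source :=
    mem_extChartAt_source _
  have hrep := contDiffAt_chartRep hy (hφ _) h₁
  have hη' : ContDiffAt ℝ ∞ (fun z => η.inChart x₁ (chartRep E E' φ x₀ x₁ z)) y :=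
    ContDiffAt.comp y (hη.contDiffAt ((extChartAt 𝓘(ℝ, E') x₁).map_source h₁)) hrep
  let J := ContinuousAlternatingMap.ofSubsingletonLIE (𝕜 := ℝ) (E := E) (F := ℝ) (0 : Fin 1)
  let J' := ContinuousAlternatingMap.ofSubsingletonLIE (𝕜 := ℝ) (E := E') (F := ℝ) (0 : Fin 1)
  have hc : ContDiffAt ℝ ∞ (fun z => J ((J'.symm (η.inChart x₁ (chartRep E E' φ x₀ x₁ z))).comp
      (fderiv ℝ (chartRep E E' φ x₀ x₁) z))) y := by
    refine J.contDiff.contDiffAt.comp y ?_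
    exact (J'.symm.contDiff.contDiffAt.comp y hη').clm_comp (hrep.fderiv_right (by simp))
  refine hc.congr_of_eventuallyEq ?_
  filter_upwards [eventually_mem_target_and_source hy hφ.continuous.continuousAt h₁] with z hz
  rw [inChart_pullback η hz.1 ((hφ _).mdifferentiableAt (by simp)) hz.2]
  obtain ⟨L, hL⟩ := J'.surjective (η.inChart x₁ (chartRep E E' φ x₀ x₁ z))
  rw [← hL, J'.symm_apply_apply]
  ext v
  rfl

end DForm

end Forms

/-! ### Differentials of functions -/

section Functions

variable {E : Type*} [NormedAddCommGroup E] [NormedSpace ℝ E]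
variable {X : Type*} [TopologicalSpace X] [ChartedSpace E X]

theorem contDiffOn_comp_extChartAt_symm [IsManifold 𝓘(ℝ, E) ∞ X] {f : X → ℝ}
    (hf : ContMDiff 𝓘(ℝ, E) 𝓘(ℝ, ℝ) ∞ f) (x₀ : X) :
    ContDiffOn ℝ ∞ (fun y => f ((extChartAt 𝓘(ℝ, E) x₀).symm y))
      (extChartAt 𝓘(ℝ, E) x₀).target := by
  rw [← contMDiffOn_iff_contDiffOn]
  exact hf.comp_contMDiffOn (contMDiffOn_extChartAt_symm x₀)

theorem contDiffAt_comp_extChartAt_symm [IsManifold 𝓘(ℝ, E) ∞ X] {f : X → ℝ}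
    (hf : ContMDiff 𝓘(ℝ, E) 𝓘(ℝ, ℝ) ∞ f) {x₀ : X} {y : E}
    (hy : y ∈ (extChartAt 𝓘(ℝ, E) x₀).target) :
    ContDiffAt ℝ ∞ (fun y => f ((extChartAt 𝓘(ℝ, E) x₀).symm y)) y :=
  (contDiffOn_comp_extChartAt_symm hf x₀).contDiffAt (extChartAt_target_mem_nhds' hy)

theorem fderiv_comp_extChartAt_symm [IsManifold 𝓘(ℝ, E) ∞ X] {f : X → ℝ}
    (hf : ContMDiff 𝓘(ℝ, E) 𝓘(ℝ, ℝ) ∞ f) {x₀ : X} {y : E}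
    (hy : y ∈ (extChartAt 𝓘(ℝ, E) x₀).target) (v : E) :
    fderiv ℝ (fun y => f ((extChartAt 𝓘(ℝ, E) x₀).symm y)) y v =
      mfderiv 𝓘(ℝ, E) 𝓘(ℝ, ℝ) f ((extChartAt 𝓘(ℝ, E) x₀).symm y)
        (mfderiv 𝓘(ℝ, E) 𝓘(ℝ, E) (extChartAt 𝓘(ℝ, E) x₀).symm y v) := by
  have h1 := (mdifferentiableAt_extChartAt_symm x₀ hy).hasMFDerivAt
  have h2 := ((hf ((extChartAt 𝓘(ℝ, E) x₀).symm y)).mdifferentiableAt (by simp)).hasMFDerivAt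
  have := (h2.comp y h1).mfderiv
  rw [mfderiv_eq_fderiv] at this
  exact congrArg (fun L => L v) this

/-- The differential of a function, as a linear form on the model space. -/
def differential (E : Type*) [NormedAddCommGroup E] [NormedSpace ℝ E] {X : Type*}
    [TopologicalSpace X] [ChartedSpace E X] (f : X → ℝ) (x : X) : E →L[ℝ] ℝ :=
  mfderiv 𝓘(ℝ, E) 𝓘(ℝ, ℝ) f x

/-- The differential of the preferred chart at `x₀`, as an endomorphism of the model space. -/
def chartDeriv (E : Type*) [NormedAddCommGroup E] [NormedSpace ℝ E] {X : Type*}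
    [TopologicalSpace X] [ChartedSpace E X] (x₀ x : X) : E →L[ℝ] E :=
  mfderiv 𝓘(ℝ, E) 𝓘(ℝ, E) (extChartAt 𝓘(ℝ, E) x₀) x

/-- The differential of a function, computed in the preferred chart at `x₀`. -/
theorem differential_eq_fderiv_chart [IsManifold 𝓘(ℝ, E) ∞ X] {f : X → ℝ}
    (hf : ContMDiff 𝓘(ℝ, E) 𝓘(ℝ, ℝ) ∞ f) {x₀ x : X}
    (hx : x ∈ (extChartAt 𝓘(ℝ, E) x₀).source) (v : E) :
    differential E f x v =
      fderiv ℝ (fun y => f ((extChartAt 𝓘(ℝ, E) x₀).symm y)) (extChartAt 𝓘(ℝ, E) x₀ x)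
        (chartDeriv E x₀ x v) := by
  rw [fderiv_comp_extChartAt_symm hf ((extChartAt 𝓘(ℝ, E) x₀).map_source hx)]
  erw [mfderiv_extChartAt_symm_mfderiv x₀ hx]
  rw [(extChartAt 𝓘(ℝ, E) x₀).left_inv hx]
  rfl

theorem differential_eq_zero_of_isLocalExtr [IsManifold 𝓘(ℝ, E) ∞ X] {f : X → ℝ}
    (hf : ContMDiff 𝓘(ℝ, E) 𝓘(ℝ, ℝ) ∞ f)
    {x : X} (h : IsLocalExtr f x) : differential E f x = 0 := by
  ext v
  rw [differential_eq_fderiv_chart hf (mem_extChartAt_source x), IsLocalExtr.fderiv_eq_zero]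
  · simp
  have hc : Tendsto (extChartAt 𝓘(ℝ, E) x).symm (𝓝 (extChartAt 𝓘(ℝ, E) x x)) (𝓝 x) := by
    have := continuousAt_extChartAt_symm (I := 𝓘(ℝ, E)) x
    rwa [ContinuousAt, extChartAt_to_inv] at this
  have hl := extChartAt_to_inv (I := 𝓘(ℝ, E)) x
  rcases h with h | h
  · refine Or.inl ?_
    filter_upwards [hc.eventually h] with y hy
    simpa only [hl] using hy
  · refine Or.inr ?_
    filter_upwards [hc.eventually h] with y hy
    simpa only [hl] using hy

end Functions

/-! ### Combinations of forms with function coefficients -/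

section Forms

variable {E : Type*} [NormedAddCommGroup E] [NormedSpace ℝ E]
variable {X : Type*} [TopologicalSpace X] [ChartedSpace E X]

namespace DForm

/-- The combination `a μ + b μ'` of two `k`-forms with functions as coefficients. -/
def comb {k : ℕ} (a b : X → ℝ) (μ μ' : DForm E X k) : DForm E X k := fun x =>
  a x • μ x + b x • μ' x

theorem inChart_comb {k : ℕ} (a b : X → ℝ) (μ μ' : DForm E X k) (x₀ : X) (y : E) :
    (comb a b μ μ').inChart x₀ y = a ((extChartAt 𝓘(ℝ, E) x₀).symm y) • μ.inChart x₀ y +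
      b ((extChartAt 𝓘(ℝ, E) x₀).symm y) • μ'.inChart x₀ y := by
  ext v; rfl

theorem IsSmooth.comb [IsManifold 𝓘(ℝ, E) ∞ X] {k : ℕ} {a b : X → ℝ} {μ μ' : DForm E X k}
    (ha : ContMDiff 𝓘(ℝ, E) 𝓘(ℝ, ℝ) ∞ a) (hb : ContMDiff 𝓘(ℝ, E) 𝓘(ℝ, ℝ) ∞ b)
    (hμ : μ.IsSmooth) (hμ' : μ'.IsSmooth) : (comb a b μ μ').IsSmooth := by
  intro x₀
  refine ContDiffOn.congr ?_ fun y _ => inChart_comb a b μ μ' x₀ y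
  exact ((contDiffOn_comp_extChartAt_symm ha x₀).smul (hμ x₀)).add
    ((contDiffOn_comp_extChartAt_symm hb x₀).smul (hμ' x₀))

theorem extDeriv_apply_two {η : E → E [⋀^Fin 1]→L[ℝ] ℝ} {y : E} (h : DifferentiableAt ℝ η y)
    (v w : E) : extDeriv η y ![v, w] = fderiv ℝ η y v ![w] - fderiv ℝ η y w ![v] := by
  have hv : ∀ u : Fin 1 → E, ∀ z, fderiv ℝ (fun x => η x u) y z = fderiv ℝ η y z u := by
    intro u z
    let L : (E [⋀^Fin 1]→L[ℝ] ℝ) →L[ℝ] ℝ := ContinuousAlternatingMap.apply ℝ E ℝ u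
    have := (L.hasFDerivAt.comp y h.hasFDerivAt).fderiv
    exact congrArg (fun L => L z) this
  rw [extDeriv_apply h, Fin.sum_univ_two, hv, hv]
  have h0 : (Fin.removeNth 0 ![v, w] : Fin 1 → E) = ![w] := by
    funext i; fin_cases i; rfl
  have h1 : (Fin.removeNth 1 ![v, w] : Fin 1 → E) = ![v] := by
    funext i; fin_cases i; rfl
  rw [h0, h1]
  simp
  ring

/-- The value of a form at a point, as a form on the model space. -/
def val {k : ℕ} (η : DForm E X k) (x : X) : E [⋀^Fin k]→L[ℝ] ℝ := η x

theorem val_d_apply_two {η : DForm E X 1} (hη : η.IsSmooth) (x : X) (v w : E) :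
    η.d.val x ![v, w] = fderiv ℝ (η.inChart x) (extChartAt 𝓘(ℝ, E) x x)
          (chartDeriv E x x v) ![chartDeriv E x x w] -
        fderiv ℝ (η.inChart x) (extChartAt 𝓘(ℝ, E) x x)
          (chartDeriv E x x w) ![chartDeriv E x x v] := by
  rw [← extDeriv_apply_two (hη.differentiableAt (mem_extChartAt_target x))]
  refine congrArg (extDeriv _ _) ?_
  funext i
  fin_cases i <;> rfl

theorem inChart_self_apply_one [IsManifold 𝓘(ℝ, E) ∞ X] (η : DForm E X 1) (x : X) (v : E) :
    η.inChart x (extChartAt 𝓘(ℝ, E) x x) ![chartDeriv E x x v] = η.val x ![v] := by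
  refine apply_congr η (extChartAt_to_inv x) ?_
  funext i
  fin_cases i
  exact mfderiv_extChartAt_symm_mfderiv x (mem_extChartAt_source x) v

/-- The Leibniz rule for the exterior derivative of a combination of `1`-forms. -/
theorem val_d_comb_apply [IsManifold 𝓘(ℝ, E) ∞ X] {a b : X → ℝ} {μ μ' : DForm E X 1}
    (ha : ContMDiff 𝓘(ℝ, E) 𝓘(ℝ, ℝ) ∞ a) (hb : ContMDiff 𝓘(ℝ, E) 𝓘(ℝ, ℝ) ∞ b)
    (hμ : μ.IsSmooth) (hμ' : μ'.IsSmooth) (x : X) (v w : E) :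
    (comb a b μ μ').d.val x ![v, w] = a x * μ.d.val x ![v, w] + b x * μ'.d.val x ![v, w] +
      (differential E a x v * μ.val x ![w] - differential E a x w * μ.val x ![v]) +
      (differential E b x v * μ'.val x ![w] -
        differential E b x w * μ'.val x ![v]) := by
  rw [val_d_apply_two (IsSmooth.comb ha hb hμ hμ'), val_d_apply_two hμ, val_d_apply_two hμ']
  have hy := mem_extChartAt_target (I := 𝓘(ℝ, E)) x
  have hs := mem_extChartAt_source (I := 𝓘(ℝ, E)) x
  rw [differential_eq_fderiv_chart ha hs v, differential_eq_fderiv_chart ha hs w,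
    differential_eq_fderiv_chart hb hs v, differential_eq_fderiv_chart hb hs w,
    ← inChart_self_apply_one μ x v, ← inChart_self_apply_one μ x w,
    ← inChart_self_apply_one μ' x v, ← inChart_self_apply_one μ' x w]
  have hda := (contDiffAt_comp_extChartAt_symm ha hy).differentiableAt (by simp)
  have hdb := (contDiffAt_comp_extChartAt_symm hb hy).differentiableAt (by simp)
  have hD := ((hda.hasFDerivAt.smul (hμ.differentiableAt hy).hasFDerivAt).add
    (hdb.hasFDerivAt.smul (hμ'.differentiableAt hy).hasFDerivAt)).fderiv
  have hfun : (comb a b μ μ').inChart x = fun y =>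
      a ((extChartAt 𝓘(ℝ, E) x).symm y) • μ.inChart x y +
        b ((extChartAt 𝓘(ℝ, E) x).symm y) • μ'.inChart x y :=
    funext fun y => inChart_comb a b μ μ' x y
  rw [hfun]
  erw [hD]
  simp only [_root_.add_apply, _root_.smul_apply,
    ContinuousAlternatingMap.add_apply, ContinuousAlternatingMap.smul_apply,
    ContinuousLinearMap.smulRight_apply, smul_eq_mul, extChartAt_to_inv]
  ring

end DForm

end Forms

/-! ### Nondegenerate two-forms on a vector space -/

section LinearAlgebra

variable {E : Type*} [NormedAddCommGroup E] [NormedSpace ℝ E]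

theorem alternating_two_swap (s : E [⋀^Fin 2]→L[ℝ] ℝ) (v w : E) : s ![v, w] = -s ![w, v] := by
  have h := s.map_swap ![w, v] (i := 0) (j := 1) (by decide)
  refine Eq.trans (congrArg s.toAlternatingMap ?_) h
  funext i
  fin_cases i <;> rfl

theorem alternating_two_self (s : E [⋀^Fin 2]→L[ℝ] ℝ) (v : E) : s ![v, v] = 0 := by
  have := alternating_two_swap s v v
  linarith

theorem alternating_two_comb (s : E [⋀^Fin 2]→L[ℝ] ℝ) (a b : ℝ) (u v w : E) :
    s ![a • u + b • v, w] = a * s ![u, w] + b * s ![v, w] := by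
  have h : ∀ z, s ![z, w] = s.curryLeft z ![w] := fun z => rfl
  rw [h, h, h]
  simp

/-- If `ι(C) s = γ` for a nondegenerate `2`-form `s`, then the form `c s + β ∧ γ` is
nondegenerate as soon as `c` and `c + β C` do not vanish. -/
theorem eq_zero_of_wedge_eq_zero {s : E [⋀^Fin 2]→L[ℝ] ℝ}
    (hs : ∀ v, (∀ w, s ![v, w] = 0) → v = 0) {β : E →L[ℝ] ℝ} {γ : E → ℝ} {C : E}
    (hC : ∀ w, s ![C, w] = γ w) {c : ℝ} (hc : c ≠ 0) (hcC : c + β C ≠ 0) {v : E}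
    (hv : ∀ w, c * s ![v, w] + (β v * γ w - β w * γ v) = 0) : v = 0 := by
  -- Testing against C gives (c + β C) γ(v) = 0, because s(v, C) = -γ(v) and γ(C) = s(C, C) = 0.
  have h1 := hv C
  rw [alternating_two_swap, hC, ← hC C, alternating_two_self] at h1
  have hγ : γ v = 0 := by
    have : (c + β C) * γ v = 0 := by linarith
    exact (mul_eq_zero.1 this).resolve_left hcC
  have h2 : c • v + β v • C = 0 := by
    refine hs _ fun w => ?_
    rw [alternating_two_comb, hC]
    have := hv w
    rw [hγ] at this
    linarith
  -- Applying β to c v + β(v) C = 0 produces the same factor c + β C.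
  have hβ : β v = 0 := by
    have h3 := congrArg β h2
    simp only [map_add, map_smul, smul_eq_mul, map_zero] at h3
    have : (c + β C) * β v = 0 := by linarith
    exact (mul_eq_zero.1 this).resolve_left hcC
  rw [hβ, zero_smul, add_zero] at h2
  exact (smul_eq_zero.1 h2).resolve_left hc

theorem isInvertible_curryLeft [FiniteDimensional ℝ E] {s : E [⋀^Fin 2]→L[ℝ] ℝ}
    (hs : ∀ v, (∀ w, s ![v, w] = 0) → v = 0) : s.curryLeft.IsInvertible := by
  let J := ContinuousAlternatingMap.ofSubsingletonLIE (𝕜 := ℝ) (E := E) (F := ℝ) (0 : Fin 1)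
  let D : (E →L[ℝ] ℝ) ≃ₗ[ℝ] Module.Dual ℝ E := LinearMap.toContinuousLinearMap.symm
  have e : E [⋀^Fin 1]→L[ℝ] ℝ ≃ₗ[ℝ] Module.Dual ℝ E := J.symm.toLinearEquiv.trans D
  have : FiniteDimensional ℝ (E [⋀^Fin 1]→L[ℝ] ℝ) := e.symm.finiteDimensional
  have hrank : Module.finrank ℝ E = Module.finrank ℝ (E [⋀^Fin 1]→L[ℝ] ℝ) := by
    rw [e.finrank_eq, Subspace.dual_finrank_eq]
  have hinj : Function.Injective s.curryLeft.toLinearMap := by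
    rw [← LinearMap.ker_eq_bot, LinearMap.ker_eq_bot']
    intro v hv
    refine hs v fun w => ?_
    exact congrArg (fun η : E [⋀^Fin 1]→L[ℝ] ℝ => η ![w]) hv
  have hsurj := (LinearMap.injective_iff_surjective_of_finrank_eq_finrank hrank).1 hinj
  refine ⟨(LinearEquiv.ofBijective s.curryLeft.toLinearMap ⟨hinj, hsurj⟩).toContinuousLinearEquiv,
    ?_⟩
  ext v
  rfl

theorem ext_apply_one {η ζ : E [⋀^Fin 1]→L[ℝ] ℝ} (h : ∀ w, η ![w] = ζ ![w]) : η = ζ := by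
  ext v
  have : v = ![v 0] := by funext i; fin_cases i; rfl
  rw [this]
  exact h _

end LinearAlgebra

/-! ### Liouville fields -/

section DualFields

variable {E : Type*} [NormedAddCommGroup E] [NormedSpace ℝ E]
variable {X : Type*} [TopologicalSpace X] [ChartedSpace E X]

/-- The field is obtained point by point, with no regularity claim; the only regularity used later
is the continuity in `continuous_differential_dualField`. -/
theorem exists_isDualField [FiniteDimensional ℝ E] {σ : DForm E X 2}
    (hσ : ∀ x v, (∀ w, σ.val x ![v, w] = 0) → v = 0) (μ : DForm E X 1) :
    ∃ Z : X → E, IsDualField σ μ Z := by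
  refine ⟨fun x => (σ.val x).curryLeft.inverse (μ.val x), fun x w => ?_⟩
  have h := ((isInvertible_curryLeft (hσ x)).inverse_apply_eq (y := μ.val x)).1 rfl
  exact (congrArg (fun η : E [⋀^Fin 1]→L[ℝ] ℝ => η ![w]) h).symm

/-- In a chart, Z is the inverse of v ↦ ι(v)σ applied to μ, and inversion is continuous at
invertible maps. This continuity of df(Z) stands in for smoothness of Z in all compactness
arguments. -/
theorem continuous_differential_dualField [FiniteDimensional ℝ E] [IsManifold 𝓘(ℝ, E) ∞ X]
    {σ : DForm E X 2} (hσ : IsSymplectic σ) {μ : DForm E X 1} (hμ : μ.IsSmooth) {Z : X → E}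
    (hZ : IsDualField σ μ Z) {f : X → ℝ} (hf : ContMDiff 𝓘(ℝ, E) 𝓘(ℝ, ℝ) ∞ f) :
    Continuous fun x => differential E f x (Z x) := by
  rw [continuous_iff_continuousAt]
  intro x₀
  have hs := mem_extChartAt_source (I := 𝓘(ℝ, E)) x₀
  have hy₀ := mem_extChartAt_target (I := 𝓘(ℝ, E)) x₀
  have hnd : ∀ y ∈ (extChartAt 𝓘(ℝ, E) x₀).target, (σ.inChart x₀ y).curryLeft.IsInvertible := by
    intro y hy
    refine isInvertible_curryLeft fun v hv => ?_
    set x := (extChartAt 𝓘(ℝ, E) x₀).symm y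
    set D : E →L[ℝ] E := mfderiv 𝓘(ℝ, E) 𝓘(ℝ, E) (extChartAt 𝓘(ℝ, E) x₀).symm y with hD
    have hx : x ∈ (extChartAt 𝓘(ℝ, E) x₀).source := (extChartAt 𝓘(ℝ, E) x₀).map_target hy
    have hr := (extChartAt 𝓘(ℝ, E) x₀).right_inv hy
    have h0 : D v = 0 := by
      refine hσ.nondegenerate x (D v) fun w => ?_
      have h1 : D (chartDeriv E x₀ x w) = w := by
        have := mfderiv_extChartAt_symm_mfderiv x₀ hx w
        rw [hr] at this
        exact this
      have h2 := hv (chartDeriv E x₀ x w)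
      rw [← h2]
      refine DForm.apply_congr σ rfl ?_
      funext i
      fin_cases i
      · rfl
      · exact h1.symm
    have h3 := mfderiv_extChartAt_mfderiv_symm x₀ hy v
    have h4 : chartDeriv E x₀ x (D v) = v := h3
    rw [← h4, h0, map_zero]
  have hval : ∀ x ∈ (extChartAt 𝓘(ℝ, E) x₀).source, differential E f x (Z x) =
      fderiv ℝ (fun y => f ((extChartAt 𝓘(ℝ, E) x₀).symm y)) (extChartAt 𝓘(ℝ, E) x₀ x)
        ((σ.inChart x₀ (extChartAt 𝓘(ℝ, E) x₀ x)).curryLeft.inverse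
          (μ.inChart x₀ (extChartAt 𝓘(ℝ, E) x₀ x))) := by
    intro x hx
    rw [differential_eq_fderiv_chart hf hx]
    congr 1
    symm
    rw [(hnd _ ((extChartAt 𝓘(ℝ, E) x₀).map_source hx)).inverse_apply_eq]
    refine ext_apply_one fun w => ?_
    have hl := (extChartAt 𝓘(ℝ, E) x₀).left_inv hx
    set D : E →L[ℝ] E := mfderiv 𝓘(ℝ, E) 𝓘(ℝ, E) (extChartAt 𝓘(ℝ, E) x₀).symm
      (extChartAt 𝓘(ℝ, E) x₀ x) with hD
    refine Eq.trans (DForm.apply_congr μ hl (w := ![D w]) ?_) ((hZ x (D w)).symm.trans ?_)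
    · funext i; fin_cases i; rfl
    · refine DForm.apply_congr σ hl.symm ?_
      funext i
      fin_cases i
      · exact (mfderiv_extChartAt_symm_mfderiv x₀ hx (Z x)).symm
      · rfl
  have hcont : ContinuousAt (fun y => fderiv ℝ (fun y => f ((extChartAt 𝓘(ℝ, E) x₀).symm y)) y
        ((σ.inChart x₀ y).curryLeft.inverse (μ.inChart x₀ y))) (extChartAt 𝓘(ℝ, E) x₀ x₀) := by
    have h1 : ContinuousAt (fun y => fderiv ℝ (fun y => f ((extChartAt 𝓘(ℝ, E) x₀).symm y)) y)
        (extChartAt 𝓘(ℝ, E) x₀ x₀) :=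
      ((contDiffAt_comp_extChartAt_symm hf hy₀).fderiv_right (m := ∞) (by simp)).continuousAt
    have h2 : ContinuousAt (fun y => (σ.inChart x₀ y).curryLeft) (extChartAt 𝓘(ℝ, E) x₀ x₀) :=
      (ContinuousAlternatingMap.curryLeftLI (𝕜 := ℝ) (E := E) (F := ℝ)
        (n := 1)).continuous.continuousAt.comp (hσ.smooth.contDiffAt hy₀).continuousAt
    obtain ⟨e, he⟩ := hnd _ hy₀
    have h3 : ContinuousAt (ContinuousLinearMap.inverse (R := ℝ) (M := E)
        (M₂ := E [⋀^Fin 1]→L[ℝ] ℝ)) (σ.inChart x₀ (extChartAt 𝓘(ℝ, E) x₀ x₀)).curryLeft := by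
      rw [← he]
      exact (contDiffAt_map_inverse (n := 0) e).continuousAt
    have h4 := ContinuousAt.comp (f := fun y => (σ.inChart x₀ y).curryLeft) h3 h2
    exact h1.clm_apply (h4.clm_apply (hμ.contDiffAt hy₀).continuousAt)
  have hcomp := ContinuousAt.comp (f := extChartAt 𝓘(ℝ, E) x₀) hcont (continuousAt_extChartAt x₀)
  refine hcomp.congr ?_
  filter_upwards [extChartAt_source_mem_nhds (I := 𝓘(ℝ, E)) x₀] with x hx
  exact (hval x hx).symm

end DualFields

/-! ### Calculus rules for differentials -/

section Calculus

variable {E : Type*} [NormedAddCommGroup E] [NormedSpace ℝ E]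
variable {X : Type*} [TopologicalSpace X] [ChartedSpace E X]

theorem differential_congr {f g : X → ℝ} {x : X} (h : f =ᶠ[𝓝 x] g) :
    differential E f x = differential E g x :=
  h.mfderiv_eq

theorem hasMFDerivAt_differential {f : X → ℝ} (hf : ContMDiff 𝓘(ℝ, E) 𝓘(ℝ, ℝ) ∞ f) (x : X) :
    HasMFDerivAt 𝓘(ℝ, E) 𝓘(ℝ, ℝ) f x (differential E f x) :=
  ((hf x).mdifferentiableAt (by simp)).hasMFDerivAt

theorem differential_const (c : ℝ) (x : X) : differential E (fun _ : X => c) x = 0 :=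
  mfderiv_const

theorem differential_add {f g : X → ℝ} (hf : ContMDiff 𝓘(ℝ, E) 𝓘(ℝ, ℝ) ∞ f)
    (hg : ContMDiff 𝓘(ℝ, E) 𝓘(ℝ, ℝ) ∞ g) (x : X) :
    differential E (fun y => f y + g y) x = differential E f x + differential E g x :=
  ((hasMFDerivAt_differential hf x).add (hasMFDerivAt_differential hg x)).mfderiv

theorem differential_mul {f g : X → ℝ} (hf : ContMDiff 𝓘(ℝ, E) 𝓘(ℝ, ℝ) ∞ f)
    (hg : ContMDiff 𝓘(ℝ, E) 𝓘(ℝ, ℝ) ∞ g) (x : X) :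
    differential E (fun y => f y * g y) x =
      f x • differential E g x + g x • differential E f x :=
  ((hasMFDerivAt_differential hf x).mul (hasMFDerivAt_differential hg x)).mfderiv

theorem differential_const_mul {f : X → ℝ} (hf : ContMDiff 𝓘(ℝ, E) 𝓘(ℝ, ℝ) ∞ f) (c : ℝ) (x : X) :
    differential E (fun y => c * f y) x = c • differential E f x :=
  ((hasMFDerivAt_differential hf x).const_smul c).mfderiv

theorem contMDiff_sum_real {ι : Type*} (s : Finset ι) {f : ι → X → ℝ}
    (hf : ∀ i, ContMDiff 𝓘(ℝ, E) 𝓘(ℝ, ℝ) ∞ (f i)) :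
    ContMDiff 𝓘(ℝ, E) 𝓘(ℝ, ℝ) ∞ fun y => ∑ i ∈ s, f i y :=
  contMDiff_finsetSum fun i _ => hf i

theorem differential_sum {ι : Type*} (s : Finset ι) {f : ι → X → ℝ}
    (hf : ∀ i, ContMDiff 𝓘(ℝ, E) 𝓘(ℝ, ℝ) ∞ (f i)) (x : X) :
    differential E (fun y => ∑ i ∈ s, f i y) x = ∑ i ∈ s, differential E (f i) x := by
  classical
  induction s using Finset.induction_on with
  | empty => simpa using differential_const 0 x
  | insert i s hi ih =>
    simp only [Finset.sum_insert hi]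
    rw [differential_add (hf i) (contMDiff_sum_real s hf), ih]

theorem differential_comp_apply {f : X → ℝ} (hf : ContMDiff 𝓘(ℝ, E) 𝓘(ℝ, ℝ) ∞ f) {h : ℝ → ℝ}
    (hh : ContDiff ℝ ∞ h) (x : X) (v : E) :
    differential E (fun y => h (f y)) x v = deriv h (f x) * differential E f x v := by
  have h1 := ((hh.differentiable (by simp)) (f x)).hasFDerivAt.hasMFDerivAt
  have h2 := (h1.comp x (hasMFDerivAt_differential hf x)).mfderiv
  refine (congrArg (fun L : E →L[ℝ] ℝ => L v) h2).trans ?_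
  change fderiv ℝ h (f x) (differential E f x v) = _
  rw [fderiv_eq_smul_deriv, smul_eq_mul, mul_comm]

/-- A point near p with f < 0 has a whole neighbourhood in D, so it is interior. -/
theorem IsDefiningFunctionAt.eventually_frontier {D : Set X} {f : X → ℝ} {p : X}
    (h : IsDefiningFunctionAt E D f p) (hD : IsClosed D) :
    ∀ᶠ x in 𝓝 p, x ∈ frontier D → f x = 0 := by
  filter_upwards [h.mem_iff.eventually_nhds] with x hx hxD
  refine le_antisymm (hx.self_of_nhds.1 (hD.frontier_subset hxD)) (not_lt.1 fun hlt => ?_)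
  have h1 : ∀ᶠ y in 𝓝 x, f y < 0 := h.smooth.continuous.continuousAt.eventually (gt_mem_nhds hlt)
  refine hxD.2 (mem_interior_iff_mem_nhds.2 ?_)
  filter_upwards [h1, hx] with y hy1 hy2 using hy2.2 hy1.le

end Calculus

/-! ### Defining functions and cutoffs for domains with outward pointing boundary -/

section Domains

variable {E : Type*} [NormedAddCommGroup E] [NormedSpace ℝ E] [FiniteDimensional ℝ E]
variable {X : Type*} [TopologicalSpace X] [T2Space X] [SigmaCompactSpace X] [LocallyCompactSpace X]
variable [ChartedSpace E X] [IsManifold 𝓘(ℝ, E) ∞ X]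

/-- A compact domain along whose boundary `Z` is outward pointing is a sublevel set of a single
smooth function that increases along `Z` at the boundary. -/
theorem exists_global_definingFunction {V : Set X} (hV : IsCompactDomain E V) {Z : X → E}
    (hZ : ∀ f : X → ℝ, ContMDiff 𝓘(ℝ, E) 𝓘(ℝ, ℝ) ∞ f →
      Continuous fun x => differential E f x (Z x)) (hout : IsOutwardAlong Z V) :
    ∃ ρ : X → ℝ, ContMDiff 𝓘(ℝ, E) 𝓘(ℝ, ℝ) ∞ ρ ∧ (∀ x, x ∈ V ↔ ρ x ≤ 0) ∧
      (∀ x ∈ frontier V, ρ x = 0 ∧ 0 < differential E ρ x (Z x)) ∧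
      ∃ C : Set X, IsCompact C ∧ ∀ x ∉ C, ρ x = 1 := by
  obtain ⟨C, hC, hVC⟩ := exists_compact_superset hV.compact
  have hcl := hV.compact.isClosed
  -- Local models: -1 in the interior of V, a defining function near the frontier, 1 off V. Every
  -- condition imposed on the values is convex, so it survives a partition of unity.
  have hloc : ∀ x : X, ∃ (W : Set X) (f : X → ℝ), IsOpen W ∧ x ∈ W ∧
      ContMDiff 𝓘(ℝ, E) 𝓘(ℝ, ℝ) ∞ f ∧ (∀ y ∈ W, y ∈ V ↔ f y ≤ 0) ∧
      (∀ y ∈ W, y ∈ frontier V → f y = 0 ∧ 0 < differential E f y (Z y)) ∧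
      ∀ y ∈ W, y ∉ C → f y = 1 := by
    intro x
    by_cases hx : x ∈ V
    · by_cases hxi : x ∈ interior V
      · refine ⟨interior V, fun _ => -1, isOpen_interior, hxi, contMDiff_const, fun y hy => ?_,
          fun y hy hyf => absurd hy hyf.2, fun y hy hyC => ?_⟩
        · simp [interior_subset hy]
        · exact absurd (interior_subset (hVC (interior_subset hy))) hyC
      · have hxf : x ∈ frontier V := ⟨subset_closure hx, hxi⟩
        obtain ⟨f, hf, hpos⟩ := hout x hxf
        have h1 : ∀ᶠ y in 𝓝 x, 0 < differential E f y (Z y) :=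
          (hZ f hf.smooth).continuousAt.eventually (lt_mem_nhds hpos)
        have h2 : ∀ᶠ y in 𝓝 x, y ∈ interior C := isOpen_interior.mem_nhds (hVC hx)
        obtain ⟨W, hW, hWo, hxW⟩ := eventually_nhds_iff.1
          (hf.mem_iff.and ((hf.eventually_frontier hcl).and (h1.and h2)))
        exact ⟨W, f, hWo, hxW, hf.smooth, fun y hy => (hW y hy).1,
          fun y hy hyf => ⟨(hW y hy).2.1 hyf, (hW y hy).2.2.1⟩,
          fun y hy hyC => absurd (interior_subset (hW y hy).2.2.2) hyC⟩
    · refine ⟨Vᶜ, fun _ => 1, hcl.isOpen_compl, hx, contMDiff_const, fun y hy => ?_,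
        fun y hy hyf => absurd (hcl.frontier_subset hyf) hy, fun _ _ _ => rfl⟩
      have hy' : y ∉ V := hy
      simp only [hy', false_iff]
      norm_num
  choose W f hWo hxW hf hmem hfr hC1 using hloc
  obtain ⟨χ, hχ⟩ := SmoothPartitionOfUnity.exists_isSubordinate 𝓘(ℝ, E) isClosed_univ W hWo
    (fun x _ => mem_iUnion.2 ⟨x, hxW x⟩)
  have hsub : ∀ i y, χ i y ≠ 0 → y ∈ W i := fun i y h => hχ i (subset_tsupport _ h)
  set ρ : X → ℝ := fun y => ∑ᶠ i, χ i y • f i y with hρ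
  have hρs : ContMDiff 𝓘(ℝ, E) 𝓘(ℝ, ℝ) ∞ ρ :=
    χ.contMDiff_finsum_smul fun i x _ => (hf i) x
  refine ⟨ρ, hρs, fun x => ⟨fun hx => ?_, fun hx => ?_⟩, fun p hp => ⟨?_, ?_⟩, C, hC,
    fun x hx => ?_⟩
  · exact χ.finsum_smul_mem_convex (mem_univ x) (t := Iic (0 : ℝ)) (g := f)
      (fun i hi => (hmem i x (hsub i x hi)).1 hx) (convex_Iic 0)
  · by_contra hxV
    have : ρ x ∈ Ioi (0 : ℝ) := χ.finsum_smul_mem_convex (mem_univ x) (t := Ioi (0 : ℝ)) (g := f)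
      (fun i hi => not_le.1 fun hle => hxV ((hmem i x (hsub i x hi)).2 hle)) (convex_Ioi 0)
    exact absurd hx (not_le.2 this)
  · exact χ.finsum_smul_mem_convex (mem_univ p) (t := {(0 : ℝ)}) (g := f)
      (fun i hi => (hfr i p (hsub i p hi) hp).1) (convex_singleton 0)
  · have hev : ρ =ᶠ[𝓝 p] fun y => ∑ i ∈ χ.fintsupport p, χ i y * f i y := by
      filter_upwards [χ.eventually_finsupport_subset p] with y hy
      rw [hρ]
      simp only [smul_eq_mul]
      refine finsum_eq_sum_of_support_subset _ fun i hi => hy ?_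
      rw [SmoothPartitionOfUnity.mem_finsupport]
      exact left_ne_zero_of_mul hi
    have hχs : ∀ i, ContMDiff 𝓘(ℝ, E) 𝓘(ℝ, ℝ) ∞ (fun y => χ i y) := fun i => (χ i).contMDiff
    rw [differential_congr hev,
      differential_sum (f := fun i y => χ i y * f i y) _ fun i => (hχs i).mul (hf i)]
    rw [_root_.sum_apply]
    -- The terms with dχ_i drop out because every contributing f_i vanishes at p.
    have hterm : ∀ i ∈ χ.fintsupport p, differential E (fun y => χ i y * f i y) p (Z p) =
        χ i p * differential E (f i) p (Z p) := by
      intro i hi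
      rw [SmoothPartitionOfUnity.mem_fintsupport_iff] at hi
      rw [differential_mul (hχs i) (hf i), (hfr i p (hχ i hi) hp).1]
      simp
    rw [Finset.sum_congr rfl hterm]
    have hpos : ∀ i ∈ χ.fintsupport p, 0 < differential E (f i) p (Z p) := fun i hi =>
      (hfr i p (hχ i ((SmoothPartitionOfUnity.mem_fintsupport_iff ..).1 hi)) hp).2
    obtain ⟨i, hi⟩ := χ.exists_pos_of_mem (mem_univ p)
    refine Finset.sum_pos' (fun i hi => mul_nonneg (χ.nonneg i p) (hpos i hi).le) ⟨i, ?_, ?_⟩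
    · rw [SmoothPartitionOfUnity.mem_fintsupport_iff]
      exact subset_tsupport _ hi.ne'
    · refine mul_pos hi (hpos i ?_)
      rw [SmoothPartitionOfUnity.mem_fintsupport_iff]
      exact subset_tsupport _ hi.ne'
  · exact χ.finsum_smul_mem_convex (mem_univ x) (t := {(1 : ℝ)}) (g := f)
      (fun i hi => hC1 i x (hsub i x hi) hx) (convex_singleton 1)

/-- A function that vanishes on the domain, is `1` outside a compact set and does not decrease
along `Z`. -/
theorem exists_monotone_cutoff {V : Set X} (hV : IsCompactDomain E V) {Z : X → E}
    (hZ : ∀ f : X → ℝ, ContMDiff 𝓘(ℝ, E) 𝓘(ℝ, ℝ) ∞ f →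
      Continuous fun x => differential E f x (Z x)) (hout : IsOutwardAlong Z V) :
    ∃ w : X → ℝ, ContMDiff 𝓘(ℝ, E) 𝓘(ℝ, ℝ) ∞ w ∧ (∀ x, w x ∈ Icc (0 : ℝ) 1) ∧
      (∀ x ∈ V, w x = 0) ∧ (∀ x, 0 ≤ differential E w x (Z x)) ∧
      ∃ C : Set X, IsCompact C ∧ ∀ x ∉ C, w x = 1 := by
  obtain ⟨ρ, hρ, hmem, hfr, C, hC, hC1⟩ := exists_global_definingFunction hV hZ hout
  have hN : IsOpen {x | 0 < differential E ρ x (Z x)} := isOpen_lt continuous_const (hZ ρ hρ)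
  set N := {x | 0 < differential E ρ x (Z x)}
  have hK : IsCompact (C \ (interior V ∪ N)) := hC.diff (isOpen_interior.union hN)
  have hpos : ∀ x ∈ C \ (interior V ∪ N), 0 < ρ x := by
    intro x hx
    by_contra h
    have hxV := (hmem x).2 (not_lt.1 h)
    by_cases hi : x ∈ interior V
    · exact hx.2 (Or.inl hi)
    · exact hx.2 (Or.inr (hfr x ⟨subset_closure hxV, hi⟩).2)
  -- The scale ε is chosen so that all points outside V with ρ < ε lie in N, where ρ increases along
  -- Z. So the cutoff h ∘ ρ varies only inside N, and off N it is at its minimum 0 or its maximum 1.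
  obtain ⟨ε, hε, hε1, hεK⟩ : ∃ ε : ℝ, 0 < ε ∧ ε ≤ 1 ∧ ∀ x ∈ C \ (interior V ∪ N), ε ≤ ρ x := by
    rcases (C \ (interior V ∪ N)).eq_empty_or_nonempty with h | h
    · exact ⟨1, one_pos, le_rfl, fun x hx => by rw [h] at hx; exact absurd hx (notMem_empty x)⟩
    · obtain ⟨x₀, hx₀, hmin⟩ := hK.exists_isMinOn h hρ.continuous.continuousOn
      exact ⟨min 1 (ρ x₀), lt_min one_pos (hpos x₀ hx₀), min_le_left _ _,
        fun x hx => (min_le_right _ _).trans (hmin hx)⟩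
  have hεC : ∀ x, x ∉ V → x ∉ N → ε ≤ ρ x := by
    intro x hxV hxN
    by_cases hxC : x ∈ C
    · exact hεK x ⟨hxC, fun h => h.elim (fun h => hxV (interior_subset h)) hxN⟩
    · rw [hC1 x hxC]; exact hε1
  set h : ℝ → ℝ := fun t => Real.smoothTransition (t / ε) with hh
  have hhs : ContDiff ℝ ∞ h := Real.smoothTransition.contDiff.comp (contDiff_id.div_const ε)
  have hmono : Monotone h := fun a b hab =>
    Real.smoothTransition.monotone (div_le_div_of_nonneg_right hab hε.le)
  have hws : ContMDiff 𝓘(ℝ, E) 𝓘(ℝ, ℝ) ∞ fun x => h (ρ x) := hhs.contMDiff.comp hρ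
  have h01 : ∀ t, h t ∈ Icc (0 : ℝ) 1 := fun t =>
    ⟨Real.smoothTransition.nonneg _, Real.smoothTransition.le_one _⟩
  have h0 : ∀ t ≤ 0, h t = 0 := fun t ht =>
    Real.smoothTransition.zero_of_nonpos (div_nonpos_of_nonpos_of_nonneg ht hε.le)
  have h1 : ∀ t, ε ≤ t → h t = 1 := fun t ht =>
    Real.smoothTransition.one_of_one_le ((one_le_div hε).2 ht)
  refine ⟨fun x => h (ρ x), hws, fun x => h01 _, fun x hx => h0 _ ((hmem x).1 hx), fun x => ?_,
    C, hC, fun x hx => h1 _ (by rw [hC1 x hx]; exact hε1)⟩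
  by_cases hxN : x ∈ N
  · rw [differential_comp_apply hρ hhs]
    exact mul_nonneg (hmono.deriv_nonneg) (le_of_lt hxN)
  · have : IsLocalExtr (fun x => h (ρ x)) x := by
      by_cases hxV : x ∈ V
      · refine Or.inl (Eventually.of_forall fun y => ?_)
        simp only [h0 _ ((hmem x).1 hxV)]
        exact (h01 _).1
      · refine Or.inr (Eventually.of_forall fun y => ?_)
        simp only [h1 _ (hεC x hxV hxN)]
        exact (h01 _).2
    rw [differential_eq_zero_of_isLocalExtr hws this]
    simp

/-- A small multiple of a second field may be added to `Z` without losing that it points outward. -/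
theorem exists_outward_margin {V : Set X} (hV : IsCompactDomain E V) {Z Z' : X → E}
    (hZ : ∀ f : X → ℝ, ContMDiff 𝓘(ℝ, E) 𝓘(ℝ, ℝ) ∞ f →
      Continuous fun x => differential E f x (Z x))
    (hZ' : ∀ f : X → ℝ, ContMDiff 𝓘(ℝ, E) 𝓘(ℝ, ℝ) ∞ f →
      Continuous fun x => differential E f x (Z' x)) (hout : IsOutwardAlong Z V) :
    ∃ δ : ℝ, 0 < δ ∧ ∀ p ∈ frontier V, ∀ (a b : ℝ) (W : X → E), 0 < a → 0 ≤ b → b ≤ δ * a →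
      W p = a • Z p + b • Z' p → ∃ f : X → ℝ, IsDefiningFunctionAt E V f p ∧
        (0 : ℝ) < mfderiv 𝓘(ℝ, E) 𝓘(ℝ, ℝ) f p (W p) := by
  obtain ⟨ρ, hρ, hmem, hfr, C, hC, hC1⟩ := exists_global_definingFunction hV hZ hout
  have hK : IsCompact (frontier V) :=
    hV.compact.of_isClosed_subset isClosed_frontier hV.compact.isClosed.frontier_subset
  obtain ⟨δ, hδ, hδV⟩ : ∃ δ : ℝ, 0 < δ ∧ ∀ p ∈ frontier V,
      δ * |differential E ρ p (Z' p)| < differential E ρ p (Z p) := by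
    rcases (frontier V).eq_empty_or_nonempty with h | h
    · exact ⟨1, one_pos, fun x hx => by rw [h] at hx; exact absurd hx (notMem_empty x)⟩
    · obtain ⟨x₀, hx₀, hmin⟩ := hK.exists_isMinOn h (hZ ρ hρ).continuousOn
      obtain ⟨x₁, hx₁, hmax⟩ := hK.exists_isMaxOn h (hZ' ρ hρ).abs.continuousOn
      set m := differential E ρ x₀ (Z x₀)
      set B := |differential E ρ x₁ (Z' x₁)|
      have hm : 0 < m := (hfr x₀ hx₀).2
      have hB : 0 ≤ B := abs_nonneg _
      -- Here m is the minimum of dρ(Z) and B the maximum of |dρ(Z')| on the compact frontier; B + 1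
      -- keeps the denominator positive.
      refine ⟨m / (B + 1), by positivity, fun p hp => ?_⟩
      have h1 : m ≤ differential E ρ p (Z p) := hmin hp
      have h2 : |differential E ρ p (Z' p)| ≤ B := hmax hp
      calc m / (B + 1) * |differential E ρ p (Z' p)| ≤ m / (B + 1) * B := by gcongr
        _ < m := by rw [div_mul_eq_mul_div, div_lt_iff₀ (by positivity)]; nlinarith
        _ ≤ _ := h1
  refine ⟨δ, hδ, fun p hp a b W ha hb hab hW => ⟨ρ, ⟨hρ, (hfr p hp).1, fun h => ?_,
    Eventually.of_forall hmem⟩, ?_⟩⟩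
  · have h1 := (hfr p hp).2
    rw [show differential E ρ p = 0 from h] at h1
    simp at h1
  · change 0 < differential E ρ p (W p)
    rw [hW, map_add, map_smul, map_smul, smul_eq_mul, smul_eq_mul]
    have h1 := hδV p hp
    have h2 := neg_abs_le (differential E ρ p (Z' p))
    have h3 := abs_nonneg (differential E ρ p (Z' p))
    nlinarith [mul_le_mul_of_nonneg_left h2 hb, mul_le_mul_of_nonneg_right hab h3,
      mul_lt_mul_of_pos_left h1 ha]

end Domains

/-! ### Integral curves, convex exhaustions and barriers -/

section Exhaustions

variable {E : Type*} [NormedAddCommGroup E] [NormedSpace ℝ E]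
variable {X : Type*} [TopologicalSpace X] [ChartedSpace E X]

theorem hasDerivAt_comp_integralCurve {γ : ℝ → X} {Z : X → E}
    (hγ : IsMIntegralCurve (I := 𝓘(ℝ, E)) γ Z) {f : X → ℝ}
    (hf : ContMDiff 𝓘(ℝ, E) 𝓘(ℝ, ℝ) ∞ f) (t : ℝ) :
    HasDerivAt (fun s => f (γ s)) (differential E f (γ t) (Z (γ t))) t := by
  have h := (hasMFDerivAt_differential hf (γ t)).comp t (hγ t)
  have h1 : HasFDerivAt (fun s => f (γ s)) ((differential E f (γ t)).comp
      ((1 : ℝ →L[ℝ] ℝ).smulRight (Z (γ t)))) t := h.hasFDerivAt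
  have h2 := h1.hasDerivAt
  simpa using h2

/-- An integral curve of an outward pointing field crosses the boundary from the inside to the
outside. -/
theorem IsOutwardAlong.eventually_crosses {V : Set X} {γ : ℝ → X} {Z : X → E}
    (hout : IsOutwardAlong Z V) (hγ : IsMIntegralCurve (I := 𝓘(ℝ, E)) γ Z) {t : ℝ}
    (ht : γ t ∈ frontier V) : ∀ᶠ s in 𝓝 t, (t < s → γ s ∉ V) ∧ (s < t → γ s ∈ V) := by
  obtain ⟨f, hf, hpos⟩ := hout (γ t) ht
  have hd := hasDerivAt_comp_integralCurve hγ hf.smooth t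
  have hpos' : 0 < deriv (fun s => f (γ s)) t := by
    rw [hd.deriv]
    exact hpos
  have hsign := eventually_nhdsWithin_sign_eq_of_deriv_pos hpos' hf.zero
  filter_upwards [hsign, hγ.continuous.continuousAt.eventually hf.mem_iff] with s hs hm
  refine ⟨fun hlt h => ?_, fun hlt => hm.2 ?_⟩
  · rw [sign_pos (sub_pos.2 hlt), sign_eq_one_iff] at hs
    exact absurd (hm.1 h) (not_le.2 hs)
  · rw [sign_neg (sub_neg.2 hlt), sign_eq_neg_one_iff] at hs
    exact hs.le

/-- An integral curve that starts at a boundary point never comes back to the domain. -/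
theorem IsOutwardAlong.notMem_of_pos {V : Set X} (hV : IsClosed V) {γ : ℝ → X} {Z : X → E}
    (hout : IsOutwardAlong Z V) (hγ : IsMIntegralCurve (I := 𝓘(ℝ, E)) γ Z)
    (h0 : γ 0 ∈ frontier V) {t : ℝ} (ht : 0 < t) : γ t ∉ V := by
  intro htV
  obtain ⟨ε, hε, hεV⟩ := Metric.eventually_nhds_iff.1 (hout.eventually_crosses hγ h0)
  have hout0 : ∀ s, 0 < s → s < ε → γ s ∉ V := fun s hs hsε =>
    (hεV (by rwa [Real.dist_eq, sub_zero, abs_of_pos hs])).1 hs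
  -- The set of return times is closed, since times below ε are excluded. At its infimum the curve
  -- would enter V from outside, whereas it can meet the frontier only from inside.
  set A := {s | 0 < s ∧ γ s ∈ V} with hA
  have hAε : A = Ici ε ∩ γ ⁻¹' V := by
    ext s
    constructor
    · rintro ⟨hs, hsV⟩
      exact ⟨not_lt.1 fun h => hout0 s hs h hsV, hsV⟩
    · rintro ⟨hs, hsV⟩
      exact ⟨hε.trans_le hs, hsV⟩
  have hAc : IsClosed A := by
    rw [hAε]
    exact isClosed_Ici.inter (hV.preimage hγ.continuous)
  have hAb : BddBelow A := ⟨0, fun s hs => hs.1.le⟩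
  have hmem : sInf A ∈ A := hAc.csInf_mem ⟨t, ht, htV⟩ hAb
  have hbefore : ∀ s, 0 < s → s < sInf A → γ s ∉ V := fun s hs hlt h =>
    absurd (csInf_le hAb ⟨hs, h⟩) (not_le.2 hlt)
  have hnear : ∀ᶠ s in 𝓝[<] (sInf A), γ s ∉ V := by
    filter_upwards [self_mem_nhdsWithin, mem_nhdsWithin_of_mem_nhds (lt_mem_nhds hmem.1)]
      with s hs hs0 using hbefore s hs0 hs
  have hfr : γ (sInf A) ∈ frontier V := by
    refine ⟨subset_closure hmem.2, fun hi => ?_⟩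
    have h1 : ∀ᶠ s in 𝓝 (sInf A), γ s ∈ V :=
      hγ.continuous.continuousAt.eventually (mem_interior_iff_mem_nhds.1 hi)
    obtain ⟨s, hs1, hs2⟩ := (hnear.and (mem_nhdsWithin_of_mem_nhds h1)).exists
    exact hs1 hs2
  have h2 := (hout.eventually_crosses hγ hfr).filter_mono (nhdsWithin_le_nhds (s := Iio (sInf A)))
  obtain ⟨s, ⟨hs1, hs2⟩, hs3⟩ := ((hnear.and h2).and self_mem_nhdsWithin).exists
  exact hs1 (hs2.2 hs3)

theorem IsConvexExhaustion.monotone {Z : X → E} {V : ℕ → Set X}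
    (h : IsConvexExhaustion Z V) : Monotone V := monotone_nat_of_le_succ h.nested

/-- A point x in no interior is a frontier point of every V_j containing it. Its trajectory then
leaves all of these V_j forever, yet γ(1), defined by completeness, lies in V_j for large j. -/
theorem IsConvexExhaustion.iUnion_interior [T2Space X] {Z : X → E} {V : ℕ → Set X}
    (h : IsConvexExhaustion Z V) (hc : IsCompleteField Z) : ⋃ j, interior (V j) = univ := by
  refine eq_univ_of_forall fun x => ?_
  by_contra hx
  have hx' : ∀ j, x ∉ interior (V j) := fun j hj => hx (mem_iUnion.2 ⟨j, hj⟩)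
  obtain ⟨γ, hγ0, hγ⟩ := hc x
  obtain ⟨m, hm⟩ := mem_iUnion.1 (h.exhausts.symm ▸ mem_univ x : x ∈ ⋃ j, V j)
  obtain ⟨n, hn⟩ := mem_iUnion.1 (h.exhausts.symm ▸ mem_univ (γ 1) : γ 1 ∈ ⋃ j, V j)
  have hfr : γ 0 ∈ frontier (V (max m n)) := by
    rw [hγ0]
    exact ⟨subset_closure (h.monotone (le_max_left m n) hm), hx' _⟩
  exact (h.outward (max m n)).notMem_of_pos (h.domain _).compact.isClosed hγ hfr one_pos
    (h.monotone (le_max_right m n) hn)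

/-- `D` is a compact domain containing `K` along whose boundary `Z` is outward pointing, and `w` is
a function which vanishes on `K`, is `1` outside the interior of `D` and does not decrease
along `Z`. -/
structure IsBarrier (Z : X → E) (K D : Set X) (w : X → ℝ) : Prop where
  domain : IsCompactDomain E D
  outward : IsOutwardAlong Z D
  subset : K ⊆ D
  smooth : ContMDiff 𝓘(ℝ, E) 𝓘(ℝ, ℝ) ∞ w
  mem_Icc : ∀ x, w x ∈ Icc (0 : ℝ) 1
  zero : ∀ x ∈ K, w x = 0
  one : ∀ x ∉ interior D, w x = 1
  nonneg : ∀ x, 0 ≤ differential E w x (Z x)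

/-- Outside interior D \ K the function is at its global minimum 0 or maximum 1. This includes the
points of ∂K and ∂D, which is where it is needed. -/
theorem IsBarrier.differential_eq_zero [IsManifold 𝓘(ℝ, E) ∞ X] {Z : X → E} {K D : Set X}
    {w : X → ℝ} (h : IsBarrier Z K D w) {x : X} (hx : x ∈ interior D → x ∈ K) :
    differential E w x = 0 := by
  refine differential_eq_zero_of_isLocalExtr h.smooth ?_
  by_cases hxD : x ∈ interior D
  · refine Or.inl (Eventually.of_forall fun y => ?_)
    rw [h.zero x (hx hxD)]
    exact (h.mem_Icc y).1
  · refine Or.inr (Eventually.of_forall fun y => ?_)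
    rw [h.one x hxD]
    exact (h.mem_Icc y).2

theorem IsConvexExhaustion.exists_interior_superset {Z : X → E} {V : ℕ → Set X}
    (h : IsConvexExhaustion Z V) (hint : ⋃ j, interior (V j) = univ) {K : Set X}
    (hK : IsCompact K) : ∃ j, K ⊆ interior (V j) :=
  hK.elim_directed_cover _ (fun _ => isOpen_interior) (hint ▸ subset_univ K)
    (Monotone.directed_le fun _ _ hij => interior_mono (h.monotone hij))

theorem IsConvexExhaustion.exists_isBarrier [FiniteDimensional ℝ E] [T2Space X]
    [SigmaCompactSpace X] [LocallyCompactSpace X] [IsManifold 𝓘(ℝ, E) ∞ X] {Z : X → E}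
    {V : ℕ → Set X} (h : IsConvexExhaustion Z V) (hint : ⋃ j, interior (V j) = univ)
    (hZ : ∀ f : X → ℝ, ContMDiff 𝓘(ℝ, E) 𝓘(ℝ, ℝ) ∞ f →
      Continuous fun x => differential E f x (Z x)) (n : ℕ) {K : Set X} (hK : IsCompact K) :
    ∃ (D : Set X) (w : X → ℝ), IsBarrier Z K D w ∧ V n ⊆ D := by
  obtain ⟨i, hi⟩ := h.exists_interior_superset hint hK
  obtain ⟨w, hw, h01, h0, hnn, C, hC, hC1⟩ := exists_monotone_cutoff (h.domain i) hZ (h.outward i)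
  -- The domain V_j must swallow the compact set off which the cutoff is 1, as well as V_i (so it
  -- contains K) and V_n.
  obtain ⟨j, hj⟩ := h.exists_interior_superset hint (hC.union (h.domain (max i n)).compact)
  have hij : V (max i n) ⊆ V j := fun x hx => interior_subset (hj (Or.inr hx))
  refine ⟨V j, w, ⟨h.domain j, h.outward j, ?_, hw, h01, fun x hx => h0 x ?_, fun x hx => ?_, hnn⟩,
    (h.monotone (le_max_right i n)).trans hij⟩
  · exact fun x hx => hij (h.monotone (le_max_left i n) (interior_subset (hi hx)))
  · exact interior_subset (hi hx)
  · exact hC1 x fun hxC => hx (hj (Or.inl hxC))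

end Exhaustions

/-- Constants growing fast enough, alternately in two sequences. -/
theorem exists_alternating_constants {δ δ' : ℕ → ℝ} (hδ : ∀ k, 0 < δ k) (hδ' : ∀ k, 0 < δ' k) :
    ∃ c c' : ℕ → ℝ, (∀ k, 0 ≤ c k) ∧ (∀ k, 0 ≤ c' k) ∧
      (∀ k, 1 + ∑ j ∈ Finset.range k, c' j ≤ δ k * c k) ∧
      ∀ k, 1 + ∑ j ∈ Finset.range (k + 1), c j ≤ δ' k * c' k := by
  -- The recursion carries the pair of partial sums of c and c'; each new constant is the least one
  -- that its inequality allows.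
  let next : ℕ → ℝ × ℝ → ℝ := fun k P => (1 + P.2) / δ k
  let next' : ℕ → ℝ × ℝ → ℝ := fun k P => (1 + (P.1 + next k P)) / δ' k
  let P : ℕ → ℝ × ℝ := fun n =>
    Nat.rec (0, 0) (fun k P => (P.1 + next k P, P.2 + next' k P)) n
  have hP : ∀ k, P (k + 1) = ((P k).1 + next k (P k), (P k).2 + next' k (P k)) := fun k => rfl
  have h1 : ∀ k, (P k).1 = ∑ j ∈ Finset.range k, next j (P j) := by
    intro k
    induction k with
    | zero => rfl
    | succ k ih => rw [Finset.sum_range_succ, ← ih, hP]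
  have h2 : ∀ k, (P k).2 = ∑ j ∈ Finset.range k, next' j (P j) := by
    intro k
    induction k with
    | zero => rfl
    | succ k ih => rw [Finset.sum_range_succ, ← ih, hP]
  have hpos : ∀ k, 0 ≤ (P k).1 ∧ 0 ≤ (P k).2 := by
    intro k
    induction k with
    | zero => exact ⟨le_rfl, le_rfl⟩
    | succ k ih =>
      have := hδ k
      have := hδ' k
      have h3 := ih.1
      have h4 := ih.2
      have h5 : 0 ≤ next k (P k) := by simp only [next]; positivity
      have h6 : 0 ≤ next' k (P k) := by simp only [next']; positivity
      rw [hP]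
      exact ⟨add_nonneg h3 h5, add_nonneg h4 h6⟩
  have hc : ∀ k, 0 ≤ next k (P k) := fun k =>
    div_nonneg (add_nonneg zero_le_one (hpos k).2) (hδ k).le
  refine ⟨fun k => next k (P k), fun k => next' k (P k), hc, fun k =>
    div_nonneg (add_nonneg zero_le_one (add_nonneg (hpos k).1 (hc k))) (hδ' k).le, fun k => ?_,
    fun k => ?_⟩
  · rw [← h2, mul_div_cancel₀ _ (hδ k).ne']
  · rw [Finset.sum_range_succ, ← h1]
    exact (mul_div_cancel₀ _ (hδ' k).ne').ge

/-! ### Locally finite sums of functions -/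

section Sums

variable {E : Type*} [NormedAddCommGroup E] [NormedSpace ℝ E]
variable {X : Type*} [TopologicalSpace X] [ChartedSpace E X]

theorem exists_locallyFinite_sum {w : ℕ → X → ℝ}
    (hw : ∀ k, ContMDiff 𝓘(ℝ, E) 𝓘(ℝ, ℝ) ∞ (w k)) (c : ℕ → ℝ)
    (hloc : ∀ x, ∃ n, ∀ᶠ y in 𝓝 x, ∀ k, n ≤ k → w k y = 0) :
    ∃ f : X → ℝ, ContMDiff 𝓘(ℝ, E) 𝓘(ℝ, ℝ) ∞ f ∧
      (∀ x n, (∀ k, n ≤ k → w k x = 0) → f x = 1 + ∑ k ∈ Finset.range n, c k * w k x) ∧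
      ∀ x, ∃ n, differential E f x = ∑ k ∈ Finset.range n, c k • differential E (w k) x := by
  set f : X → ℝ := fun x => 1 + ∑' k, c k * w k x with hf
  have hval : ∀ x n, (∀ k, n ≤ k → w k x = 0) → f x = 1 + ∑ k ∈ Finset.range n, c k * w k x := by
    intro x n h
    rw [hf]
    simp only
    rw [tsum_eq_sum (s := Finset.range n)]
    intro k hk
    rw [h k (by simpa using hk), mul_zero]
  have hcw : ∀ k, ContMDiff 𝓘(ℝ, E) 𝓘(ℝ, ℝ) ∞ fun x => c k * w k x := fun k =>
    contMDiff_const.mul (hw k)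
  have hsum : ∀ n, ContMDiff 𝓘(ℝ, E) 𝓘(ℝ, ℝ) ∞ fun x => ∑ k ∈ Finset.range n, c k * w k x :=
    fun n => contMDiff_sum_real _ hcw
  refine ⟨f, fun x => ?_, hval, fun x => ?_⟩
  · obtain ⟨n, hn⟩ := hloc x
    have hs : ContMDiff 𝓘(ℝ, E) 𝓘(ℝ, ℝ) ∞ fun x => 1 + ∑ k ∈ Finset.range n, c k * w k x :=
      contMDiff_const.add (hsum n)
    refine (hs x).congr_of_eventuallyEq ?_
    filter_upwards [hn] with y hy using hval y n hy
  · obtain ⟨n, hn⟩ := hloc x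
    refine ⟨n, ?_⟩
    have hev : f =ᶠ[𝓝 x] fun x => 1 + ∑ k ∈ Finset.range n, c k * w k x := by
      filter_upwards [hn] with y hy using hval y n hy
    rw [differential_congr hev, differential_add contMDiff_const (hsum n), differential_const,
      zero_add, differential_sum _ hcw]
    exact Finset.sum_congr rfl fun k _ => differential_const_mul (hw k) (c k) x

end Sums

/-! ### Interpolating functions on interleaved exhaustions -/

section Interpolation

variable {E : Type*} [NormedAddCommGroup E] [NormedSpace ℝ E]
variable {X : Type*} [TopologicalSpace X] [ChartedSpace E X]

/-- Along the boundary of `V`, all fields `a Z + b Z'` with `0 ≤ b ≤ δ a` point outward. -/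
def HasMargin (Z Z' : X → E) (V : Set X) (δ : ℝ) : Prop :=
  ∀ p ∈ frontier V, ∀ (a b : ℝ) (W : X → E), 0 < a → 0 ≤ b → b ≤ δ * a →
    W p = a • Z p + b • Z' p → ∃ f : X → ℝ, IsDefiningFunctionAt E V f p ∧
      (0 : ℝ) < mfderiv 𝓘(ℝ, E) 𝓘(ℝ, ℝ) f p (W p)

/-- An exhaustion by domains along whose boundaries `f` and `g` are critical and the ratio `g / f`
is so small that the fields `a Z + b Z'` with `b / a ≤ g / f` point outward. -/
structure IsDominatedExhaustion (Z Z' : X → E) (f g : X → ℝ) (D : ℕ → Set X) : Prop where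
  domain : ∀ k, IsCompactDomain E (D k)
  nested : ∀ k, D k ⊆ D (k + 1)
  exhausts : ⋃ k, D k = univ
  margin : ∀ k, ∃ δ, 0 < δ ∧ HasMargin Z Z' (D k) δ ∧ ∀ p ∈ frontier (D k),
    differential E f p = 0 ∧ differential E g p = 0 ∧ g p ≤ δ * f p

/-- Barriers for Z and for Z' are built in turn, each starting from the domain of the previous one.
Requiring V_k ⊆ D_k makes the interiors of the D_k cover X. -/
theorem exists_interleaved_barriers [FiniteDimensional ℝ E] [T2Space X]
    [SigmaCompactSpace X] [LocallyCompactSpace X] [IsManifold 𝓘(ℝ, E) ∞ X] {Z Z' : X → E}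
    {V V' : ℕ → Set X} (h : IsConvexExhaustion Z V) (h' : IsConvexExhaustion Z' V')
    (hint : ⋃ j, interior (V j) = univ) (hint' : ⋃ j, interior (V' j) = univ)
    (hZ : ∀ f : X → ℝ, ContMDiff 𝓘(ℝ, E) 𝓘(ℝ, ℝ) ∞ f →
      Continuous fun x => differential E f x (Z x))
    (hZ' : ∀ f : X → ℝ, ContMDiff 𝓘(ℝ, E) 𝓘(ℝ, ℝ) ∞ f →
      Continuous fun x => differential E f x (Z' x)) :
    ∃ (C D D' : ℕ → Set X) (w w' : ℕ → X → ℝ), ∀ k, IsBarrier Z (C k) (D k) (w k) ∧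
      IsBarrier Z' (D k) (D' k) (w' k) ∧ C (k + 1) = D' k ∧ V k ⊆ D k := by
  have hstep : ∀ (n : ℕ) (K : {K : Set X // IsCompact K}), ∃ (D : Set X) (w : X → ℝ),
      IsBarrier Z K D w ∧ V n ⊆ D := fun n K => h.exists_isBarrier hint hZ n K.2
  have hstep' : ∀ K : {K : Set X // IsCompact K}, ∃ (D : Set X) (w : X → ℝ),
      IsBarrier Z' K D w := fun K => by
    obtain ⟨D, w, hD, -⟩ := h'.exists_isBarrier hint' hZ' 0 K.2
    exact ⟨D, w, hD⟩
  choose D w hD hVD using hstep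
  choose D' w' hD' using hstep'
  let next : ℕ → {K : Set X // IsCompact K} → {K : Set X // IsCompact K} := fun n K =>
    ⟨D n K, (hD n K).domain.compact⟩
  let next' : {K : Set X // IsCompact K} → {K : Set X // IsCompact K} := fun K =>
    ⟨D' K, (hD' K).domain.compact⟩
  let C : ℕ → {K : Set X // IsCompact K} := fun n =>
    Nat.rec ⟨∅, isCompact_empty⟩ (fun k K => next' (next k K)) n
  exact ⟨fun k => (C k).1, fun k => D k (C k), fun k => D' (next k (C k)), fun k => w k (C k),
    fun k => w' (next k (C k)), fun k => ⟨hD k (C k), hD' (next k (C k)), rfl, hVD k (C k)⟩⟩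

/-- Two functions, increasing along `Z` and along `Z'` respectively, which dominate each other
alternately along the boundaries of interleaved exhaustions. -/
theorem exists_interpolating_functions [FiniteDimensional ℝ E] [T2Space X]
    [SigmaCompactSpace X] [LocallyCompactSpace X] [IsManifold 𝓘(ℝ, E) ∞ X] {Z Z' : X → E}
    {V V' : ℕ → Set X} (h : IsConvexExhaustion Z V) (h' : IsConvexExhaustion Z' V')
    (hint : ⋃ j, interior (V j) = univ) (hint' : ⋃ j, interior (V' j) = univ)
    (hZ : ∀ f : X → ℝ, ContMDiff 𝓘(ℝ, E) 𝓘(ℝ, ℝ) ∞ f →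
      Continuous fun x => differential E f x (Z x))
    (hZ' : ∀ f : X → ℝ, ContMDiff 𝓘(ℝ, E) 𝓘(ℝ, ℝ) ∞ f →
      Continuous fun x => differential E f x (Z' x)) :
    ∃ f g : X → ℝ, ContMDiff 𝓘(ℝ, E) 𝓘(ℝ, ℝ) ∞ f ∧ ContMDiff 𝓘(ℝ, E) 𝓘(ℝ, ℝ) ∞ g ∧
      (∀ x, 0 < f x) ∧ (∀ x, 0 < g x) ∧ (∀ x, 0 ≤ differential E f x (Z x)) ∧
      (∀ x, 0 ≤ differential E g x (Z' x)) ∧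
      (∀ x, differential E f x = 0 ∨ differential E g x = 0) ∧
      (∃ D, IsDominatedExhaustion Z Z' f g D) ∧ ∃ D', IsDominatedExhaustion Z' Z g f D' := by
  obtain ⟨C, D, D', w, w', hall⟩ := exists_interleaved_barriers h h' hint hint' hZ hZ'
  have hb : ∀ k, IsBarrier Z (C k) (D k) (w k) := fun k => (hall k).1
  have hb' : ∀ k, IsBarrier Z' (D k) (D' k) (w' k) := fun k => (hall k).2.1
  have hC : ∀ k, C (k + 1) = D' k := fun k => (hall k).2.2.1
  have hD1 : ∀ k, D' k ⊆ D (k + 1) := fun k => hC k ▸ (hb (k + 1)).subset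
  have hDs : ∀ k, D k ⊆ D (k + 1) := fun k => (hb' k).subset.trans (hD1 k)
  have hDm : Monotone D := monotone_nat_of_le_succ hDs
  have hDs' : ∀ k, D' k ⊆ D' (k + 1) := fun k => (hD1 k).trans (hb' (k + 1)).subset
  have hDm' : Monotone D' := monotone_nat_of_le_succ hDs'
  have hDD' : ∀ {i j}, i ≤ j → D i ⊆ D' j := fun {i j} hij => (hDm hij).trans (hb' j).subset
  have hD'D : ∀ {i j}, i < j → D' i ⊆ D j := fun {i j} hij => (hD1 i).trans (hDm hij)
  have hD'C : ∀ {i j}, i < j → D' i ⊆ C j := by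
    intro i j hij
    obtain ⟨m, rfl⟩ := Nat.exists_eq_succ_of_ne_zero (Nat.ne_zero_of_lt hij)
    rw [Nat.succ_eq_add_one, hC]
    exact hDm' (Nat.lt_succ_iff.1 hij)
  have hDC : ∀ {i j}, i < j → D i ⊆ C j := fun {i j} hij => (hb' i).subset.trans (hD'C hij)
  have hcover : ∀ x, ∃ k, x ∈ interior (D k) := fun x => by
    obtain ⟨k, hk⟩ := mem_iUnion.1 (hint.symm ▸ mem_univ x : x ∈ ⋃ j, interior (V j))
    exact ⟨k, interior_mono (hall k).2.2.2 hk⟩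
  have hloc : ∀ x, ∃ n, ∀ᶠ y in 𝓝 x, ∀ k, n ≤ k → w k y = 0 := fun x => by
    obtain ⟨k, hk⟩ := hcover x
    refine ⟨k + 1, ?_⟩
    filter_upwards [isOpen_interior.mem_nhds hk] with y hy j hj
    exact (hb j).zero y (hDC hj (interior_subset hy))
  have hloc' : ∀ x, ∃ n, ∀ᶠ y in 𝓝 x, ∀ k, n ≤ k → w' k y = 0 := fun x => by
    obtain ⟨k, hk⟩ := hcover x
    -- The index is k here but k + 1 for w: already w'_k vanishes on D_k, whereas w_k need not.
    refine ⟨k, ?_⟩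
    filter_upwards [isOpen_interior.mem_nhds hk] with y hy j hj
    exact (hb' j).zero y (hDm hj (interior_subset hy))
  have hmargin : ∀ k, ∃ δ, 0 < δ ∧ HasMargin Z Z' (D k) δ := fun k =>
    exists_outward_margin (hb k).domain hZ hZ' (hb k).outward
  have hmargin' : ∀ k, ∃ δ, 0 < δ ∧ HasMargin Z' Z (D' k) δ := fun k =>
    exists_outward_margin (hb' k).domain hZ' hZ (hb' k).outward
  choose δ hδ hδm using hmargin
  choose δ' hδ' hδm' using hmargin'
  obtain ⟨c, c', hc, hc', hcc, hcc'⟩ := exists_alternating_constants hδ hδ'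
  obtain ⟨f, hf, hfval, hfd⟩ := exists_locallyFinite_sum (fun k => (hb k).smooth) c hloc
  obtain ⟨g, hg, hgval, hgd⟩ := exists_locallyFinite_sum (fun k => (hb' k).smooth) c' hloc'
  have hfzero : ∀ x, (∀ k, differential E (w k) x = 0) → differential E f x = 0 := by
    intro x hx
    obtain ⟨n, hn⟩ := hfd x
    rw [hn]
    exact Finset.sum_eq_zero fun k _ => by rw [hx k, smul_zero]
  have hgzero : ∀ x, (∀ k, differential E (w' k) x = 0) → differential E g x = 0 := by
    intro x hx
    obtain ⟨n, hn⟩ := hgd x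
    rw [hn]
    exact Finset.sum_eq_zero fun k _ => by rw [hx k, smul_zero]
  have hterm : ∀ k x, 0 ≤ c k * w k x := fun k x => mul_nonneg (hc k) ((hb k).mem_Icc x).1
  have hterm' : ∀ k x, 0 ≤ c' k * w' k x := fun k x => mul_nonneg (hc' k) ((hb' k).mem_Icc x).1
  have hle : ∀ k x, c k * w k x ≤ c k := fun k x =>
    mul_le_of_le_one_right (hc k) ((hb k).mem_Icc x).2
  have hle' : ∀ k x, c' k * w' k x ≤ c' k := fun k x =>
    mul_le_of_le_one_right (hc' k) ((hb' k).mem_Icc x).2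
  refine ⟨f, g, hf, hg, fun x => ?_, fun x => ?_, fun x => ?_, fun x => ?_, fun x => ?_,
    ⟨D, fun k => (hb k).domain, hDs, ?_, fun k => ⟨δ k, hδ k, hδm k, fun p hp => ?_⟩⟩,
    ⟨D', fun k => (hb' k).domain, hDs', ?_, fun k => ⟨δ' k, hδ' k, hδm' k, fun p hp => ?_⟩⟩⟩
  · obtain ⟨n, hn⟩ := hloc x
    rw [hfval x n hn.self_of_nhds]
    exact add_pos_of_pos_of_nonneg one_pos (Finset.sum_nonneg fun k _ => hterm k x)
  · obtain ⟨n, hn⟩ := hloc' x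
    rw [hgval x n hn.self_of_nhds]
    exact add_pos_of_pos_of_nonneg one_pos (Finset.sum_nonneg fun k _ => hterm' k x)
  · obtain ⟨n, hn⟩ := hfd x
    rw [hn, _root_.sum_apply]
    exact Finset.sum_nonneg fun k _ => mul_nonneg (hc k) ((hb k).nonneg x)
  · obtain ⟨n, hn⟩ := hgd x
    rw [hn, _root_.sum_apply]
    exact Finset.sum_nonneg fun k _ => mul_nonneg (hc' k) ((hb' k).nonneg x)
  · by_cases hx : ∀ k, differential E (w k) x = 0
    · exact Or.inl (hfzero x hx)
    · push Not at hx
      obtain ⟨k, hk⟩ := hx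
      have hk' : x ∈ interior (D k) ∧ x ∉ C k := by
        by_contra hcon
        exact hk ((hb k).differential_eq_zero fun hxi => by
          by_contra hxC
          exact hcon ⟨hxi, hxC⟩)
      -- A point of D_k \ C_k lies outside D'_j for j < k and inside D_j for j ≥ k, so each w'_j is
      -- constantly extremal there.
      refine Or.inr (hgzero x fun j => (hb' j).differential_eq_zero fun hxj => ?_)
      rcases lt_or_ge j k with hjk | hjk
      · exact absurd (hD'C hjk (interior_subset hxj)) hk'.2
      · exact hDm hjk (interior_subset hk'.1)
  · refine eq_univ_of_forall fun x => ?_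
    obtain ⟨k, hk⟩ := hcover x
    exact mem_iUnion.2 ⟨k, interior_subset hk⟩
  · have hpD : p ∈ D k := (hb k).domain.compact.isClosed.frontier_subset hp
    have hpi : p ∉ interior (D k) := hp.2
    refine ⟨hfzero p fun j => (hb j).differential_eq_zero fun hpj => ?_,
      hgzero p fun j => (hb' j).differential_eq_zero fun hpj => ?_, ?_⟩
    · rcases lt_or_ge k j with hkj | hkj
      · exact hDC hkj hpD
      · exact absurd (interior_mono (hDm hkj) hpj) hpi
    · rcases lt_or_ge j k with hjk | hjk
      · exact absurd (interior_mono (hD'D hjk) hpj) hpi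
      · exact hDm hjk hpD
    · have h1 : g p ≤ 1 + ∑ j ∈ Finset.range k, c' j := by
        rw [hgval p k fun j hj => (hb' j).zero p (hDm hj hpD)]
        gcongr with j
        exact hle' j p
      have h2 : c k ≤ f p := by
        rw [hfval p (k + 1) fun j hj => (hb j).zero p (hDC hj hpD), Finset.sum_range_succ,
          (hb k).one p hpi, mul_one]
        have := Finset.sum_nonneg fun j (_ : j ∈ Finset.range k) => hterm j p
        linarith
      exact (h1.trans (hcc k)).trans (mul_le_mul_of_nonneg_left h2 (hδ k).le)
  · refine eq_univ_of_forall fun x => ?_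
    obtain ⟨k, hk⟩ := hcover x
    exact mem_iUnion.2 ⟨k, (hb' k).subset (interior_subset hk)⟩
  · have hpD : p ∈ D' k := (hb' k).domain.compact.isClosed.frontier_subset hp
    have hpi : p ∉ interior (D' k) := hp.2
    refine ⟨hgzero p fun j => (hb' j).differential_eq_zero fun hpj => ?_,
      hfzero p fun j => (hb j).differential_eq_zero fun hpj => ?_, ?_⟩
    · rcases lt_or_ge k j with hkj | hkj
      · exact hD'D hkj hpD
      · exact absurd (interior_mono (hDm' hkj) hpj) hpi
    · rcases lt_or_ge k j with hkj | hkj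
      · exact hD'C hkj hpD
      · exact absurd (interior_mono (hDD' hkj) hpj) hpi
    · have h1 : f p ≤ 1 + ∑ j ∈ Finset.range (k + 1), c j := by
        rw [hfval p (k + 1) fun j hj => (hb j).zero p (hD'C hj hpD)]
        gcongr with j
        exact hle j p
      have h2 : c' k ≤ g p := by
        rw [hgval p (k + 1) fun j hj => (hb' j).zero p (hD'D hj hpD), Finset.sum_range_succ,
          (hb' k).one p hpi, mul_one]
        have := Finset.sum_nonneg fun j (_ : j ∈ Finset.range k) => hterm' j p
        linarith
      exact (h1.trans (hcc' k)).trans (mul_le_mul_of_nonneg_left h2 (hδ' k).le)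

end Interpolation

/-! ### Homotopies through combinations of two Liouville forms -/

section Paths

variable {E : Type*} [NormedAddCommGroup E] [NormedSpace ℝ E]
variable {X : Type*} [TopologicalSpace X] [ChartedSpace E X]
variable {σ : DForm E X 2} {μ μ' : DForm E X 1} {Z Z' : X → E}

/-- A combination of two Liouville forms for the same symplectic form is a Liouville form if its
coefficients are increasing along the respective Liouville fields, never both at once. -/
theorem isLiouvilleForm_comb [IsManifold 𝓘(ℝ, E) ∞ X] (hμ : IsLiouvilleFormFor σ μ)
    (hμ' : IsLiouvilleFormFor σ μ')
    (hZ : IsDualField σ μ Z) (hZ' : IsDualField σ μ' Z') {a b : X → ℝ}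
    (ha : ContMDiff 𝓘(ℝ, E) 𝓘(ℝ, ℝ) ∞ a) (hb : ContMDiff 𝓘(ℝ, E) 𝓘(ℝ, ℝ) ∞ b)
    (ha0 : ∀ x, 0 < a x) (hb0 : ∀ x, 0 ≤ b x) (haZ : ∀ x, 0 ≤ differential E a x (Z x))
    (hbZ : ∀ x, 0 ≤ differential E b x (Z' x))
    (hab : ∀ x, differential E a x = 0 ∨ differential E b x = 0) :
    IsLiouvilleForm (DForm.comb a b μ μ') := by
  have hs := DForm.IsSmooth.comb ha hb hμ.smooth hμ'.smooth
  suffices hnondeg : ∀ (x : X) (v : E),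
      (∀ w : E, (DForm.comb a b μ μ').d.val x ![v, w] = 0) → v = 0 from
    ⟨⟨hs.d, DForm.d_d hs, hnondeg⟩, hs, rfl⟩
  intro x v hv
  have hnd : ∀ v : E, (∀ w : E, σ.val x ![v, w] = 0) → v = 0 :=
    fun v => hμ.symplectic.nondegenerate x v
  have hpos : 0 < a x + b x := add_pos_of_pos_of_nonneg (ha0 x) (hb0 x)
  simp only [DForm.val_d_comb_apply ha hb hμ.smooth hμ'.smooth, hμ.d_eq, hμ'.d_eq] at hv
  rcases hab x with h | h
  · refine eq_zero_of_wedge_eq_zero (β := differential E b x) (γ := fun w => μ'.val x ![w])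
      (C := Z' x) (c := a x + b x) hnd (hZ' x) hpos.ne'
      (add_pos_of_pos_of_nonneg hpos (hbZ x)).ne' fun w => ?_
    have := hv w
    rw [h] at this
    simp only [zero_apply, zero_mul] at this
    linarith
  · refine eq_zero_of_wedge_eq_zero (β := differential E a x) (γ := fun w => μ.val x ![w])
      (C := Z x) (c := a x + b x) hnd (hZ x) hpos.ne'
      (add_pos_of_pos_of_nonneg hpos (haZ x)).ne' fun w => ?_
    have := hv w
    rw [h] at this
    simp only [zero_apply, zero_mul] at this
    linarith

/-- At a common critical point of a and b the Leibniz terms vanish, so d(aμ + bμ') = (a+b)σ there.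
-/
theorem dualField_comb_eq [IsManifold 𝓘(ℝ, E) ∞ X] (hμ : IsLiouvilleFormFor σ μ)
    (hμ' : IsLiouvilleFormFor σ μ')
    (hZ : IsDualField σ μ Z) (hZ' : IsDualField σ μ' Z') {a b : X → ℝ}
    (ha : ContMDiff 𝓘(ℝ, E) 𝓘(ℝ, ℝ) ∞ a) (hb : ContMDiff 𝓘(ℝ, E) 𝓘(ℝ, ℝ) ∞ b)
    {W : X → E} (hW : IsDualField (DForm.comb a b μ μ').d (DForm.comb a b μ μ') W) {p : X}
    (hap : differential E a p = 0) (hbp : differential E b p = 0) (hab : a p + b p ≠ 0) :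
    W p = (a p / (a p + b p)) • Z p + (b p / (a p + b p)) • Z' p := by
  have hnd : ∀ v : E, (∀ w : E, σ.val p ![v, w] = 0) → v = 0 :=
    fun v => hμ.symplectic.nondegenerate p v
  rw [← sub_eq_zero]
  refine hnd _ fun w => ?_
  have h1 : (DForm.comb a b μ μ').d.val p ![W p, w] = a p * μ.val p ![w] + b p * μ'.val p ![w] :=
    hW p w
  have h2 : σ.val p ![Z p, w] = μ.val p ![w] := hZ p w
  have h3 : σ.val p ![Z' p, w] = μ'.val p ![w] := hZ' p w
  rw [DForm.val_d_comb_apply ha hb hμ.smooth hμ'.smooth, hμ.d_eq, hμ'.d_eq, hap, hbp] at h1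
  simp only [zero_apply, zero_mul, sub_zero, add_zero] at h1
  have h4 := alternating_two_comb (σ.val p) 1 (-1) (W p)
    ((a p / (a p + b p)) • Z p + (b p / (a p + b p)) • Z' p) w
  have h5 := alternating_two_comb (σ.val p) (a p / (a p + b p)) (b p / (a p + b p)) (Z p) (Z' p) w
  rw [h5, h2, h3] at h4
  rw [show W p - ((a p / (a p + b p)) • Z p + (b p / (a p + b p)) • Z' p) =
    (1 : ℝ) • W p + (-1 : ℝ) • ((a p / (a p + b p)) • Z p + (b p / (a p + b p)) • Z' p) by
      rw [one_smul, neg_smul, one_smul, sub_eq_add_neg], h4]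
  field_simp
  linarith

/-- The path from `μ` to `f μ + g μ'`, parametrized by a function `r`. -/
def pathForm (f g : X → ℝ) (μ μ' : DForm E X 1) (r : ℝ → ℝ) : ℝ → DForm E X 1 := fun s =>
  DForm.comb (fun x => 1 - r s + r s * f x) (fun x => r s * g x) μ μ'

theorem isSmoothDomainFamily_const (D : Set X) : IsSmoothDomainFamily E fun _ => D := by
  refine ⟨fun _ => Diffeomorph.refl 𝓘(ℝ, E) X ∞, ?_, fun x => rfl, fun s _ => ?_⟩
  · exact contMDiff_snd.contMDiffOn
  · simp

/-- The same domains serve for all s: with t = r s, the ratio tg/(1-t+tf) of the coefficients never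
exceeds g/f, which is at most δ on each boundary. -/
theorem isSimpleLiouvilleHomotopy_pathForm [FiniteDimensional ℝ E] [IsManifold 𝓘(ℝ, E) ∞ X]
    (hμ : IsLiouvilleFormFor σ μ) (hμ' : IsLiouvilleFormFor σ μ')
    (hZ : IsDualField σ μ Z) (hZ' : IsDualField σ μ' Z') {f g : X → ℝ}
    (hf : ContMDiff 𝓘(ℝ, E) 𝓘(ℝ, ℝ) ∞ f) (hg : ContMDiff 𝓘(ℝ, E) 𝓘(ℝ, ℝ) ∞ g)
    (hf0 : ∀ x, 0 < f x) (hg0 : ∀ x, 0 < g x) (hfZ : ∀ x, 0 ≤ differential E f x (Z x))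
    (hgZ : ∀ x, 0 ≤ differential E g x (Z' x))
    (hfg : ∀ x, differential E f x = 0 ∨ differential E g x = 0) {D : ℕ → Set X}
    (hD : IsDominatedExhaustion Z Z' f g D) {r : ℝ → ℝ} (hr : ContDiff ℝ ∞ r)
    (hr01 : ∀ s ∈ Icc (0 : ℝ) 1, r s ∈ Icc (0 : ℝ) 1) :
    IsSimpleLiouvilleHomotopy (pathForm f g μ μ' r) := by
  have ha : ∀ t : ℝ, ContMDiff 𝓘(ℝ, E) 𝓘(ℝ, ℝ) ∞ fun x => 1 - t + t * f x := fun t =>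
    contMDiff_const.add (contMDiff_const.mul hf)
  have hb : ∀ t : ℝ, ContMDiff 𝓘(ℝ, E) 𝓘(ℝ, ℝ) ∞ fun x => t * g x := fun t =>
    contMDiff_const.mul hg
  have hda : ∀ t x, differential E (fun x => 1 - t + t * f x) x = t • differential E f x := by
    intro t x
    rw [differential_add (f := fun _ => 1 - t) (g := fun x => t * f x) contMDiff_const
      (contMDiff_const.mul hf), differential_const, zero_add,
      differential_const_mul hf]
  have hdb : ∀ t x, differential E (fun x => t * g x) x = t • differential E g x :=
    fun t x => differential_const_mul hg t x
  have ha0 : ∀ t ∈ Icc (0 : ℝ) 1, ∀ x, 0 < 1 - t + t * f x := by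
    intro t ht x
    rcases ht.1.eq_or_lt with h | h
    · simp [← h]
    · have := mul_pos h (hf0 x)
      linarith [ht.2]
  have hlf : ∀ s ∈ Icc (0 : ℝ) 1, IsLiouvilleForm (pathForm f g μ μ' r s) := by
    intro s hs
    have ht := hr01 s hs
    refine isLiouvilleForm_comb hμ hμ' hZ hZ' (ha _) (hb _) (ha0 _ ht)
      (fun x => mul_nonneg ht.1 (hg0 x).le) (fun x => ?_) (fun x => ?_) (fun x => ?_)
    · rw [hda]; exact mul_nonneg ht.1 (hfZ x)
    · rw [hdb]; exact mul_nonneg ht.1 (hgZ x)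
    · rw [hda, hdb]
      exact (hfg x).imp (fun h => by rw [h, smul_zero]) fun h => by rw [h, smul_zero]
  refine ⟨fun x₀ => ?_, hlf, fun k _ => D k, fun k => isSmoothDomainFamily_const (D k),
    fun s hs => ?_⟩
  · have hsnd : MapsTo (Prod.snd : ℝ × E → E) (Icc (0 : ℝ) 1 ×ˢ (extChartAt 𝓘(ℝ, E) x₀).target)
        (extChartAt 𝓘(ℝ, E) x₀).target := fun p hp => hp.2
    have hr' : ContDiffOn ℝ ∞ (fun p : ℝ × E => r p.1)
        (Icc (0 : ℝ) 1 ×ˢ (extChartAt 𝓘(ℝ, E) x₀).target) :=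
      (hr.comp contDiff_fst).contDiffOn
    have hf' := (contDiffOn_comp_extChartAt_symm hf x₀).comp contDiff_snd.contDiffOn hsnd
    have hg' := (contDiffOn_comp_extChartAt_symm hg x₀).comp contDiff_snd.contDiffOn hsnd
    have hm := (hμ.smooth x₀).comp contDiff_snd.contDiffOn hsnd
    have hm' := (hμ'.smooth x₀).comp contDiff_snd.contDiffOn hsnd
    have htot := (((contDiffOn_const (c := (1 : ℝ))).sub hr').add (hr'.mul hf')).smul hm |>.add
      ((hr'.mul hg').smul hm')
    refine htot.congr fun p _ => ?_
    exact DForm.inChart_comb _ _ μ μ' x₀ p.2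
  · obtain ⟨W, hW⟩ := exists_isDualField (σ := (pathForm f g μ μ' r s).d)
      (fun x v hv => (hlf s hs).symplectic.nondegenerate x v hv) (pathForm f g μ μ' r s)
    refine ⟨W, hW, hD.domain, hD.nested, hD.exhausts, fun k p hp => ?_⟩
    have ht := hr01 s hs
    obtain ⟨δ, hδ, hm, hcrit⟩ := hD.margin k
    obtain ⟨hfp, hgp, hgf⟩ := hcrit p hp
    have hap := ha0 _ ht p
    have hbp := mul_nonneg ht.1 (hg0 p).le
    have hpos := add_pos_of_pos_of_nonneg hap hbp
    have hWp := dualField_comb_eq hμ hμ' hZ hZ' (ha _) (hb _) hW (p := p)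
      (by rw [hda, hfp, smul_zero]) (by rw [hdb, hgp, smul_zero]) hpos.ne'
    refine hm p hp _ _ W (div_pos hap hpos) (div_nonneg hbp hpos.le) ?_ hWp
    rw [← mul_div_assoc]
    refine div_le_div_of_nonneg_right ?_ hpos.le
    have h1 := mul_le_mul_of_nonneg_left hgf ht.1
    have h2 := mul_nonneg hδ.le (sub_nonneg.2 ht.2)
    linarith

theorem IsSimpleLiouvilleHomotopy.congr {η ζ : ℝ → DForm E X 1} (h : IsSimpleLiouvilleHomotopy η)
    (hη : ∀ s ∈ Icc (0 : ℝ) 1, ζ s = η s) : IsSimpleLiouvilleHomotopy ζ := by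
  refine ⟨fun x₀ => (h.smooth x₀).congr fun p hp => ?_, fun s hs => ?_, ?_⟩
  · simp only [hη p.1 hp.1]
  · rw [hη s hs]; exact h.liouville s hs
  · obtain ⟨D, hD, hex⟩ := h.exhaustions
    refine ⟨D, hD, fun s hs => ?_⟩
    rw [hη s hs]
    exact hex s hs

/-- Two simple homotopies that match up compose to a Liouville homotopy. -/
theorem exists_isLiouvilleHomotopy_of_simple {η ζ : ℝ → DForm E X 1}
    (hη : IsSimpleLiouvilleHomotopy η) (hζ : IsSimpleLiouvilleHomotopy ζ) (h : η 1 = ζ 0) :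
    ∃ ξ : ℝ → DForm E X 1, IsLiouvilleHomotopy ξ ∧ ξ 0 = η 0 ∧ ξ 1 = ζ 1 := by
  refine ⟨fun t => if t ≤ 1 / 2 then η (2 * t) else ζ (2 * t - 1),
    ⟨2, fun i => (i : ℝ) / 2, by simp, by simp, fun i _ => by push_cast; linarith, ?_⟩, ?_, ?_⟩
  · intro i hi
    interval_cases i
    · refine hη.congr fun s hs => ?_
      have h1 : (((0 : ℕ) : ℝ) / 2 + s * (((0 + 1 : ℕ) : ℝ) / 2 - ((0 : ℕ) : ℝ) / 2)) = s / 2 := by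
        push_cast; ring
      simp only [h1]
      rw [if_pos (by linarith [hs.2])]
      congr 1
      ring
    · refine hζ.congr fun s hs => ?_
      have h1 : (((1 : ℕ) : ℝ) / 2 + s * (((1 + 1 : ℕ) : ℝ) / 2 - ((1 : ℕ) : ℝ) / 2)) =
          (1 + s) / 2 := by
        push_cast; ring
      simp only [h1]
      -- The midpoint is assigned to the first half, so at s = 0 the matching condition is needed.
      rcases hs.1.eq_or_lt with h0 | h0
      · rw [← h0, if_pos (by norm_num), ← h]
        congr 1
        norm_num
      · rw [if_neg (by linarith)]
        congr 1
        ring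
  · simp only [mul_zero]
    rw [if_pos (by norm_num)]
  · simp only
    rw [if_neg (by norm_num)]
    congr 1
    norm_num

/-- Any two convex Liouville forms for the same symplectic form are Liouville homotopic. -/
theorem exists_isLiouvilleHomotopy [FiniteDimensional ℝ E] [IsManifold 𝓘(ℝ, E) ∞ X] [T2Space X]
    [SigmaCompactSpace X] [LocallyCompactSpace X] (hμ : IsLiouvilleFormFor σ μ)
    (hμ' : IsLiouvilleFormFor σ μ') (hZ : IsDualField σ μ Z) (hZ' : IsDualField σ μ' Z')
    {V V' : ℕ → Set X}
    (h : IsConvexExhaustion Z V) (h' : IsConvexExhaustion Z' V')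
    (hint : ⋃ j, interior (V j) = univ) (hint' : ⋃ j, interior (V' j) = univ) :
    ∃ ξ : ℝ → DForm E X 1, IsLiouvilleHomotopy ξ ∧ ξ 0 = μ ∧ ξ 1 = μ' := by
  obtain ⟨f, g, hf, hg, hf0, hg0, hfZ, hgZ, hfg, ⟨D, hD⟩, D', hD'⟩ :=
    exists_interpolating_functions h h' hint hint'
      (fun _ => continuous_differential_dualField hμ.symplectic hμ.smooth hZ)
      (fun _ => continuous_differential_dualField hμ'.symplectic hμ'.smooth hZ')
  have h1 := isSimpleLiouvilleHomotopy_pathForm hμ hμ' hZ hZ' hf hg hf0 hg0 hfZ hgZ hfg hD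
    -- The second path exchanges the roles of μ and μ' and is run backwards, so both meet at fμ +
    -- gμ'.
    (r := fun s => s) contDiff_id fun s hs => hs
  have h2 := isSimpleLiouvilleHomotopy_pathForm hμ' hμ hZ' hZ hg hf hg0 hf0 hgZ hfZ
    (fun x => (hfg x).symm) hD' (r := fun s => 1 - s) (contDiff_const.sub contDiff_id)
    fun s hs => ⟨by linarith [hs.2], by linarith [hs.1]⟩
  obtain ⟨ξ, hξ, hξ0, hξ1⟩ := exists_isLiouvilleHomotopy_of_simple h1 h2 (by
    funext x
    simp [pathForm, DForm.comb, add_comm])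
  refine ⟨ξ, hξ, hξ0.trans ?_, hξ1.trans ?_⟩
  · funext x
    simp [pathForm, DForm.comb]
  · funext x
    simp [pathForm, DForm.comb]

end Paths

/-! ### Transport of the convex structure by a symplectomorphism -/

section Transport

variable {E : Type*} [NormedAddCommGroup E] [NormedSpace ℝ E]
variable {E' : Type*} [NormedAddCommGroup E'] [NormedSpace ℝ E']
variable {X : Type*} [TopologicalSpace X] [ChartedSpace E X]
variable {X' : Type*} [TopologicalSpace X'] [ChartedSpace E' X']

/-- The image of Z x under dφ satisfies the equation defining Z' at φ(x), tested on vectors in the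
image of dφ, which is everything; nondegeneracy of σ' gives uniqueness. -/
theorem mfderiv_dualField_pullback {σ' : DForm E' X' 2} (hσ' : IsSymplectic σ')
    {μ' : DForm E' X' 1} (φ : Diffeomorph 𝓘(ℝ, E) 𝓘(ℝ, E') X X' ∞) {Z : X → E} {Z' : X' → E'}
    (hZ : IsDualField (DForm.pullback φ σ') (DForm.pullback φ μ') Z)
    (hZ' : IsDualField σ' μ' Z') (x : X) :
    mfderiv 𝓘(ℝ, E) 𝓘(ℝ, E') φ x (Z x) = Z' (φ x) := by
  set L : E →L[ℝ] E' := mfderiv 𝓘(ℝ, E) 𝓘(ℝ, E') φ x with hL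
  have hsurj : Function.Surjective L :=
    (φ.mfderivToContinuousLinearEquiv (by simp) x).surjective
  change L (Z x) = Z' (φ x)
  rw [← sub_eq_zero]
  refine hσ'.nondegenerate (φ x) _ fun w' => ?_
  obtain ⟨w, rfl⟩ := hsurj w'
  change σ'.val (φ x) ![L (Z x) - Z' (φ x), L w] = 0
  have h1 : σ'.val (φ x) ![L (Z x), L w] = μ'.val (φ x) ![L w] := by
    refine Eq.trans ?_ ((hZ x w).trans ?_)
    · refine congrArg (σ'.val (φ x)) ?_
      funext i; fin_cases i <;> rfl
    · refine congrArg (μ'.val (φ x)) ?_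
      funext i; fin_cases i; rfl
  have h2 : σ'.val (φ x) ![Z' (φ x), L w] = μ'.val (φ x) ![L w] := hZ' (φ x) (L w)
  have h3 := alternating_two_comb (σ'.val (φ x)) 1 (-1) (L (Z x)) (Z' (φ x)) (L w)
  rw [h1, h2, one_smul, neg_smul, one_smul, ← sub_eq_add_neg] at h3
  rw [h3]
  ring

theorem IsConvexExhaustion.preimage (φ : Diffeomorph 𝓘(ℝ, E) 𝓘(ℝ, E') X X' ∞) {Z : X → E}
    {Z' : X' → E'} (hφ : ∀ x, mfderiv 𝓘(ℝ, E) 𝓘(ℝ, E') φ x (Z x) = Z' (φ x)) {V : ℕ → Set X'}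
    (h : IsConvexExhaustion Z' V) : IsConvexExhaustion Z fun j => φ ⁻¹' V j := by
  have hout : ∀ j, IsOutwardAlong Z (φ ⁻¹' V j) := by
    intro j p hp
    have hp' : φ p ∈ frontier (V j) := by
      have := φ.toHomeomorph.preimage_frontier (V j)
      exact (this ▸ hp : p ∈ φ ⁻¹' frontier (V j))
    obtain ⟨f, hf, hpos⟩ := h.outward j (φ p) hp'
    have hcomp := (hasMFDerivAt_differential hf.smooth (φ p)).comp p
      ((φ.contMDiff p).mdifferentiableAt (by simp)).hasMFDerivAt
    have hd : differential E (fun x => f (φ x)) p (Z p) = differential E' f (φ p) (Z' (φ p)) := by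
      rw [← hφ p]
      exact congrArg (fun L : E →L[ℝ] ℝ => L (Z p)) hcomp.mfderiv
    have hpos' : 0 < differential E (fun x => f (φ x)) p (Z p) := by
      rw [hd]; exact hpos
    refine ⟨fun x => f (φ x), ⟨hf.smooth.comp φ.contMDiff, hf.zero, fun h0 => ?_, ?_⟩, hpos'⟩
    · rw [show differential E (fun x => f (φ x)) p = 0 from h0] at hpos'
      simp at hpos'
    · exact φ.continuous.continuousAt.eventually hf.mem_iff
  refine ⟨fun j => ⟨?_, fun p hp => ?_⟩, fun j => preimage_mono (h.nested j), ?_, hout⟩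
  · exact φ.toHomeomorph.isCompact_preimage.2 (h.domain j).compact
  · obtain ⟨f, hf, -⟩ := hout j p hp
    exact ⟨f, hf⟩
  · rw [← preimage_iUnion, h.exhausts, preimage_univ]

end Transport

end Liouville

end

/-! ### The proposition -/

theorem mainTheorem5
    {E : Type*} [NormedAddCommGroup E] [NormedSpace ℝ E] [FiniteDimensional ℝ E]
    {E' : Type*} [NormedAddCommGroup E'] [NormedSpace ℝ E'] [FiniteDimensional ℝ E']
    {X : Type*} [TopologicalSpace X] [T2Space X] [SecondCountableTopology X]
    [ChartedSpace E X] [IsManifold 𝓘(ℝ, E) ∞ X]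
    {X' : Type*} [TopologicalSpace X'] [T2Space X'] [SecondCountableTopology X']
    [ChartedSpace E' X'] [IsManifold 𝓘(ℝ, E') ∞ X']
    (σ : Liouville.DForm E X 2) (μ : Liouville.DForm E X 1)
    (σ' : Liouville.DForm E' X' 2) (μ' : Liouville.DForm E' X' 1)
    (hX : Liouville.IsConvexSymplectic σ μ)
    (hX' : Liouville.IsConvexSymplectic σ' μ')
    (hsymp : ∃ φ₀ : Diffeomorph 𝓘(ℝ, E) 𝓘(ℝ, E') X X' ∞, Liouville.IsSymplectomorphism σ σ' φ₀) :
    ∃ φ : Diffeomorph 𝓘(ℝ, E) 𝓘(ℝ, E') X X' ∞, Liouville.IsSymplectomorphism σ σ' φ ∧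
      ∃ μs : ℝ → Liouville.DForm E X 1, Liouville.IsLiouvilleHomotopy μs ∧
        μs 0 = μ ∧ μs 1 = Liouville.DForm.pullback φ μ' := by
  obtain ⟨φ, hφ⟩ := hsymp
  refine ⟨φ, hφ, ?_⟩
  have hφ' : Liouville.DForm.pullback φ σ' = σ := hφ
  have : LocallyCompactSpace X := Manifold.locallyCompact_of_finiteDimensional 𝓘(ℝ, E)
  obtain ⟨Z, hZ, hZc, V, hV⟩ := hX.convex
  obtain ⟨Z', hZ', hZc', V', hV'⟩ := hX'.convex
  have hlf : Liouville.IsLiouvilleFormFor σ (Liouville.DForm.pullback φ μ') :=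
    ⟨hX.liouville.symplectic, hX'.liouville.smooth.pullback_one φ.contMDiff, by
      rw [Liouville.DForm.d_pullback hX'.liouville.smooth φ.contMDiff, hX'.liouville.d_eq, hφ']⟩
  obtain ⟨Y, hY⟩ := Liouville.exists_isDualField
    (fun x v hv => hX.liouville.symplectic.nondegenerate x v hv) (Liouville.DForm.pullback φ μ')
  have hYZ := Liouville.mfderiv_dualField_pullback hX'.liouville.symplectic φ (hφ'.symm ▸ hY) hZ'
  refine Liouville.exists_isLiouvilleHomotopy hX.liouville hlf hZ hY hV
    (Liouville.IsConvexExhaustion.preimage φ hYZ hV') (hV.iUnion_interior hZc) ?_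
  -- Covering by interiors is proved on X', where Z' is complete, and pulled back; completeness of Y
  -- is never needed.
  have h1 : ∀ j, interior (φ ⁻¹' V' j) = φ ⁻¹' interior (V' j) := fun j =>
    (φ.toHomeomorph.preimage_interior (V' j)).symm
  simp only [h1]
  rw [← Set.preimage_iUnion, hV'.iUnion_interior hZc', Set.preimage_univ]
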